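/- **Setting.** Let $\Sigma\in\mathbb R^{d\times d}$ be positive definite, $\theta\in\mathbb R^d$, $\sigma>0$. There are $m$ agents. Agent $i$ observes $d_i$ of the $d$ features: a permutation matrix $\Pi_i$ with row blocks $\Pi_{i+}\in\mathbb R^{d_i\times d}$ and $\Pi_{i-}\in\mathbb R^{(d-d_i)\times d}$ lists its observed and unobserved features, and every feature is observed by at least one agent. Write $v_{i+}=\Pi_{i+}v$, $v_{i-}=\Pi_{i-}v$, and $\Sigma_{i+}=\Pi_{i+}\Sigma\Pi_{i+}^\top$, $\Sigma_{i\pm}=\Pi_{i+}\Sigma\Pi_{i-}^\top$, $\Sigma_{i\mp}=\Pi_{i-}\Sigma\Pi_{i+}^\top$. Put $$T_i=\begin{bmatrix} I_{d_i} & \Sigma_{i+}^{-1}\Sigma_{i\pm}\end{bmatrix}\Pi_i,\qquad z_{i}=x_{i-}-\Sigma_{i\mp}\Sigma_{i+}^{-1}x_{i+},$$ $$W_i^\star=\Sigma_{i+}\big(\mathbb E[x_{i+}\theta_{i-}^\top z_{i}z_{i}^\top\theta_{i-}x_{i+}^\top]+\sigma^2\Sigma_{i+}\big)^{-1}\Sigma_{i+},\qquad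 C^\star=\Big(\sum_{i=1}^m T_i^\top W_i^\star T_i\Big)^{-1},$$ where $x$ has the common law of the feature vectors, which has mean $0$ and covariance $\Sigma$ and is such that the expectations in the $W_i^\star$ are finite. For each agent $i$ there is an infinite sequence of samples; all feature vectors (over agents and samples) are i.i.d. with this law, all noise variables are i.i.d. $\mathsf N(0,\sigma^2)$, and features and noise are independent. From its first $n$ samples agent $i$ has the feature matrix $X_i\in\mathbb R^{n\times d}$, of which it sees $X_{i+}=X_i\Pi_{i+}^\top$, and the labels $y_i=X_i\theta+\xi_i$. With $A^\dagger$ the Moore–Penrose inverse and $\|v\|_W^2=v^\top Wv$, define $$\hat\theta_i=X_{i+}^\dagger y_i,\qquad \hat\theta_i^{\mathrm{imp}}=(T_i^\top X_{i+}^\top X_{i+}T_i)^\dagger T_i^\top X_{i+}^\top y_i,$$ $$\hat\theta^{\mathrm{imp}}(W_1,\dots,W_m)=\operatorname*{argmin}_{t\in\mathbb R^d}\sum_{i=1}^m\big\|P_it-\hat\theta_i^{\mathrm{imp}}\big\|_{W_i}^2,\qquad P_i=T_i^\top(T_iT_i^\top)^{-1}T_i .$$ Call weights $W_1,\dots,W_m\in\mathbb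 R^{d\times d}$ *admissible* if they are symmetric positive semidefinite and $\sum_i P_i^\top W_iP_i\succ0$ (so that the minimizer is unique). **Theorem.** 1. Whenever $\operatorname{rank}X_{i+}=d_i$, $$\hat\theta_i^{\mathrm{imp}}=T_i^\top(T_iT_i^\top)^{-1}\hat\theta_i .$$ For each $i$, almost surely, this rank condition, and hence the identity, holds for all sufficiently large $n$. 2. All positive definite weights are admissible, and so are the weights $T_i^\top W_i^\star T_i$; moreover $\sum_i T_i^\top W_i^\star T_i\succ0$, so $C^\star$ is well defined. 3. There is a function $C^{\mathrm{imp}}$ of the weights such that for all admissible $W_1,\dots,W_m$: the minimizer $\hat\theta^{\mathrm{imp}}=\hat\theta^{\mathrm{imp}}(W_1,\dots,W_m)$ exists and is unique for every $n$ and every realization of the data; as $n\to\infty$, $\hat\theta^{\mathrm{imp}}\to\theta$ in probability and $$\sqrt n\,\big(\hat\theta^{\mathrm{imp}}-\theta\big)\xrightarrow{d}\mathsf N\big(0,C^{\mathrm{imp}}(W_1,\dots,W_m)\big);$$ the matrix $C^{\mathrm{imp}}(W_1,\dots,W_m)$ is positive semidefinite, and $C^{\mathrm{imp}}(W_1,\dots,W_m)\succeq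 C^\star$ in the p.s.d. order. Equality holds for $W_i=T_i^\top W_i^\star T_i$, $i=1,\dots,m$. -/

import Mathlib

open Matrix MeasureTheory ProbabilityTheory Filter
open scoped Topology

namespace CollabLS

/-! ### Moore–Penrose inverse -/

/-- `B` satisfies the four Penrose equations for the real matrix `A`. -/
structure IsMoorePenrose {k l : Type*} [Fintype k] [Fintype l]
    (A : Matrix k l ℝ) (B : Matrix l k ℝ) : Prop where
  mul_mul_self : A * B * A = A
  mul_mul_inv : B * A * B = B
  symm_left : (A * B)ᵀ = A * B
  symm_right : (B * A)ᵀ = B * A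

theorem IsMoorePenrose.unique {k l : Type*} [Fintype k] [Fintype l]
    {A : Matrix k l ℝ} {B C : Matrix l k ℝ} (hB : IsMoorePenrose A B)
    (hC : IsMoorePenrose A C) : B = C := by
  have h1 : A * B = A * C := by
    calc A * B = (A * C * A) * B := by rw [hC.mul_mul_self]
      _ = (A * C) * (A * B) := by simp only [Matrix.mul_assoc]
      _ = (A * C)ᵀ * (A * B)ᵀ := by rw [hC.symm_left, hB.symm_left]
      _ = ((A * B * A) * C)ᵀ := by rw [← Matrix.transpose_mul]; simp only [Matrix.mul_assoc]
      _ = A * C := by rw [hB.mul_mul_self, hC.symm_left]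
  have h2 : B * A = C * A := by
    calc B * A = B * (A * C * A) := by rw [hC.mul_mul_self]
      _ = (B * A) * (C * A) := by simp only [Matrix.mul_assoc]
      _ = (B * A)ᵀ * (C * A)ᵀ := by rw [hC.symm_right, hB.symm_right]
      _ = (C * (A * B * A))ᵀ := by rw [← Matrix.transpose_mul]; simp only [Matrix.mul_assoc]
      _ = C * A := by rw [hB.mul_mul_self, hC.symm_right]
  calc B = B * A * B := hB.mul_mul_inv.symm
    _ = C * (A * B) := by rw [h2, Matrix.mul_assoc]
    _ = C * A * C := by rw [h1, Matrix.mul_assoc]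
    _ = C := hC.mul_mul_inv

theorem exists_isMoorePenrose {k l : Type*} [Fintype k] [Fintype l] [DecidableEq l]
    (A : Matrix k l ℝ) : ∃ B, IsMoorePenrose A B := by
  obtain ⟨R, h1, h2, h3, h4⟩ : ∃ R : Matrix l l ℝ, (Aᵀ * A) * R * (Aᵀ * A) = Aᵀ * A ∧
      R * (Aᵀ * A) * R = R ∧ Rᵀ = R ∧ (R * (Aᵀ * A))ᵀ = R * (Aᵀ * A) := by
    have hS : (Aᵀ * A).IsHermitian := by
      simpa using Matrix.isHermitian_conjTranspose_mul_self A
    set U : Matrix l l ℝ := (hS.eigenvectorUnitary : Matrix l l ℝ) with hU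
    have hUU : Uᵀ * U = 1 := by
      have := Unitary.coe_star_mul_self hS.eigenvectorUnitary
      simpa [Matrix.star_eq_conjTranspose] using this
    have hs : Aᵀ * A = U * diagonal hS.eigenvalues * Uᵀ := by
      have := hS.spectral_theorem
      simpa [Unitary.conjStarAlgAut_apply, Matrix.star_eq_conjTranspose, Function.comp_def]
        using this
    have key : ∀ a b : l → ℝ, (U * diagonal a * Uᵀ) * (U * diagonal b * Uᵀ)
        = U * diagonal (fun i => a i * b i) * Uᵀ := by
      intro a b
      calc (U * diagonal a * Uᵀ) * (U * diagonal b * Uᵀ)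
          = U * diagonal a * (Uᵀ * U) * (diagonal b * Uᵀ) := by simp only [Matrix.mul_assoc]
        _ = U * (diagonal a * diagonal b) * Uᵀ := by
            rw [hUU]; simp only [Matrix.mul_assoc, Matrix.one_mul]
        _ = _ := by rw [diagonal_mul_diagonal]
    generalize hS.eigenvalues = e at hs
    clear_value U
    clear hU hS
    refine ⟨U * diagonal (fun i => (e i)⁻¹) * Uᵀ, ?_, ?_, ?_, ?_⟩
    · rw [hs, key, key]
      simp only [mul_inv_mul_cancel]
    · rw [hs, key, key]
      congr 3
      funext i
      by_cases h : e i = 0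
      · simp [h]
      · field_simp
    · simp [Matrix.mul_assoc]
    · rw [hs, key]
      simp [Matrix.mul_assoc]
  have hA : A * R * (Aᵀ * A) = A := by
    rw [← sub_eq_zero]
    rw [← Matrix.conjTranspose_mul_self_eq_zero]
    have e : A * R * (Aᵀ * A) - A = A * (R * (Aᵀ * A) - 1) := by
      rw [Matrix.mul_sub, Matrix.mul_one, Matrix.mul_assoc]
    have z : (Aᵀ * A) * (R * (Aᵀ * A) - 1) = 0 := by
      rw [Matrix.mul_sub, Matrix.mul_one, ← Matrix.mul_assoc, h1, sub_self]
    rw [e, Matrix.conjTranspose_eq_transpose_of_trivial, Matrix.transpose_mul, Matrix.mul_assoc,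
      ← Matrix.mul_assoc Aᵀ A, z, Matrix.mul_zero]
  refine ⟨R * Aᵀ, ⟨?_, ?_, ?_, ?_⟩⟩
  · simpa only [Matrix.mul_assoc] using hA
  · calc R * Aᵀ * A * (R * Aᵀ) = (R * (Aᵀ * A) * R) * Aᵀ := by simp only [Matrix.mul_assoc]
      _ = R * Aᵀ := by rw [h2]
  · simp [Matrix.transpose_mul, h3, Matrix.mul_assoc]
  · rw [Matrix.mul_assoc]; exact h4

/-- The Moore–Penrose inverse `A†` of a real matrix. -/
noncomputable def pinv {k l : Type*} [Fintype k] [Fintype l] [DecidableEq l]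
    (A : Matrix k l ℝ) : Matrix l k ℝ :=
  (exists_isMoorePenrose A).choose

theorem pinv_spec {k l : Type*} [Fintype k] [Fintype l] [DecidableEq l]
    (A : Matrix k l ℝ) : IsMoorePenrose A (pinv A) :=
  (exists_isMoorePenrose A).choose_spec

/-! ### Views of the agents -/

/-- The view of an agent: a permutation of the `d` features listing first the `obs` observed
and then the `unobs` unobserved ones. -/
structure View (d : ℕ) where
  obs : ℕ
  unobs : ℕ
  perm : Fin obs ⊕ Fin unobs ≃ Fin d

namespace View

variable {d : ℕ} (V : View d)

/-- `Π₊`, selecting the observed features. -/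
def Pplus : Matrix (Fin V.obs) (Fin d) ℝ :=
  Matrix.of fun a j => if V.perm (Sum.inl a) = j then 1 else 0

/-- `Π₋`, selecting the unobserved features. -/
def Pminus : Matrix (Fin V.unobs) (Fin d) ℝ :=
  Matrix.of fun a j => if V.perm (Sum.inr a) = j then 1 else 0

/-- The permutation matrix `Π`, with blocks `Π₊` on top of `Π₋`. -/
def P : Matrix (Fin V.obs ⊕ Fin V.unobs) (Fin d) ℝ := Matrix.fromRows V.Pplus V.Pminus

/-- `S₊ = Π₊ S Π₊ᵀ` -/
def blockPlus (S : Matrix (Fin d) (Fin d) ℝ) : Matrix (Fin V.obs) (Fin V.obs) ℝ :=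
  V.Pplus * S * V.Pplusᵀ

/-- `S± = Π₊ S Π₋ᵀ` -/
def blockPlusMinus (S : Matrix (Fin d) (Fin d) ℝ) : Matrix (Fin V.obs) (Fin V.unobs) ℝ :=
  V.Pplus * S * V.Pminusᵀ

/-- `S∓ = Π₋ S Π₊ᵀ` -/
def blockMinusPlus (S : Matrix (Fin d) (Fin d) ℝ) : Matrix (Fin V.unobs) (Fin V.obs) ℝ :=
  V.Pminus * S * V.Pplusᵀ

/-- `T = [I, Σ₊⁻¹ Σ±] Π` -/
noncomputable def T (S : Matrix (Fin d) (Fin d) ℝ) : Matrix (Fin V.obs) (Fin d) ℝ :=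
  Matrix.fromCols (1 : Matrix (Fin V.obs) (Fin V.obs) ℝ)
    ((V.blockPlus S)⁻¹ * V.blockPlusMinus S) * V.P

/-- `Tᵀ (T Tᵀ)⁻¹` -/
noncomputable def Tlift (S : Matrix (Fin d) (Fin d) ℝ) : Matrix (Fin d) (Fin V.obs) ℝ :=
  (V.T S)ᵀ * (V.T S * (V.T S)ᵀ)⁻¹

/-- The residual `z = x₋ - Σ∓ Σ₊⁻¹ x₊`. -/
noncomputable def resid (S : Matrix (Fin d) (Fin d) ℝ) (x : Fin d → ℝ) : Fin V.unobs → ℝ :=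
  V.Pminus *ᵥ x - (V.blockMinusPlus S * (V.blockPlus S)⁻¹) *ᵥ (V.Pplus *ᵥ x)

/-- Entry `(a, b)` of `x₊ θ₋ᵀ z zᵀ θ₋ x₊ᵀ`. -/
noncomputable def misfit (S : Matrix (Fin d) (Fin d) ℝ) (θ : Fin d → ℝ)
    (a b : Fin V.obs) (x : Fin d → ℝ) : ℝ :=
  (V.Pplus *ᵥ x) a * ((V.Pminus *ᵥ θ) ⬝ᵥ V.resid S x) ^ 2 * (V.Pplus *ᵥ x) b

/-- `W⋆ = Σ₊ (E[x₊ θ₋ᵀ z zᵀ θ₋ x₊ᵀ] + σ² Σ₊)⁻¹ Σ₊`, the expectation being over `x ∼ μ`. -/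
noncomputable def Wstar (μ : Measure (Fin d → ℝ)) (S : Matrix (Fin d) (Fin d) ℝ)
    (θ : Fin d → ℝ) (σ : ℝ) : Matrix (Fin V.obs) (Fin V.obs) ℝ :=
  V.blockPlus S *
    ((Matrix.of fun a b => ∫ x, V.misfit S θ a b x ∂μ) + σ ^ 2 • V.blockPlus S)⁻¹ *
    V.blockPlus S

/-! ### Local estimators

`X : Matrix (Fin n) (Fin d) ℝ` is the full data matrix of the agent (rows are samples);
the estimators use only its observed part `X₊`. -/

/-- `X₊ = X Π₊ᵀ` -/
def dataPlus {n : ℕ} (X : Matrix (Fin n) (Fin d) ℝ) : Matrix (Fin n) (Fin V.obs) ℝ :=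
  X * V.Pplusᵀ

/-- Local ordinary least squares `X₊† y`. -/
noncomputable def ols {n : ℕ} (X : Matrix (Fin n) (Fin d) ℝ) (y : Fin n → ℝ) :
    Fin V.obs → ℝ :=
  pinv (V.dataPlus X) *ᵥ y

/-- Local imputation estimator `(Tᵀ X₊ᵀ X₊ T)† Tᵀ X₊ᵀ y`. -/
noncomputable def imp (S : Matrix (Fin d) (Fin d) ℝ) {n : ℕ}
    (X : Matrix (Fin n) (Fin d) ℝ) (y : Fin n → ℝ) : Fin d → ℝ :=
  pinv ((V.T S)ᵀ * (V.dataPlus X)ᵀ * V.dataPlus X * V.T S) *ᵥ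
    (((V.T S)ᵀ * (V.dataPlus X)ᵀ) *ᵥ y)

end View

/-! ### Aggregation -/

section Aggregation

variable {d m : ℕ}

/-- The loss `∑ i, ‖Tᵢᵀ (Tᵢ Tᵢᵀ)⁻¹ Tᵢ θ - βᵢ‖²_{Wᵢ}`, where `‖v‖²_W = ⟨v, W v⟩`. -/
noncomputable def impLoss (V : Fin m → View d) (S : Matrix (Fin d) (Fin d) ℝ)
    (W : Fin m → Matrix (Fin d) (Fin d) ℝ) (β : Fin m → Fin d → ℝ) (θ : Fin d → ℝ) : ℝ :=
  ∑ i, (((V i).Tlift S * (V i).T S) *ᵥ θ - β i) ⬝ᵥ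
    (W i *ᵥ (((V i).Tlift S * (V i).T S) *ᵥ θ - β i))

/-- A global minimizer of `f` (arbitrary if there is none). -/
noncomputable def argmin (f : (Fin d → ℝ) → ℝ) : Fin d → ℝ :=
  Classical.epsilon fun θ => ∀ θ', f θ ≤ f θ'

/-- Weights for which the aggregation makes sense: positive semidefinite matrices for which the
quadratic part of the (convex) loss `impLoss` is positive definite, i.e. for which the minimizer
is unique. -/
def Admissible (V : Fin m → View d) (S : Matrix (Fin d) (Fin d) ℝ)
    (W : Fin m → Matrix (Fin d) (Fin d) ℝ) : Prop :=
  (∀ i, (W i).PosSemidef) ∧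
    (∑ i, ((V i).Tlift S * (V i).T S)ᵀ * W i * ((V i).Tlift S * (V i).T S)).PosDef

/-- `C⋆ = (∑ i, Tᵢᵀ Wᵢ⋆ Tᵢ)⁻¹` -/
noncomputable def Cstar (V : Fin m → View d) (μ : Measure (Fin d → ℝ))
    (S : Matrix (Fin d) (Fin d) ℝ) (θ : Fin d → ℝ) (σ : ℝ) : Matrix (Fin d) (Fin d) ℝ :=
  (∑ i, ((V i).T S)ᵀ * (V i).Wstar μ S θ σ * (V i).T S)⁻¹

end Aggregation

/-! ### The samples -/

section Samples

variable {Ω : Type*} {d m : ℕ}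

/-- Data matrix of agent `i` built from its first `n` feature vectors. -/
def dataMat (x : Fin m → ℕ → Ω → (Fin d → ℝ)) (i : Fin m) (n : ℕ) (ω : Ω) :
    Matrix (Fin n) (Fin d) ℝ :=
  Matrix.of fun k => x i k ω

/-- Labels `yᵢ = Xᵢ θ + ξᵢ` of the first `n` samples of agent `i`. -/
def labels (x : Fin m → ℕ → Ω → (Fin d → ℝ)) (ξ : Fin m → ℕ → Ω → ℝ) (θ : Fin d → ℝ)
    (i : Fin m) (n : ℕ) (ω : Ω) : Fin n → ℝ :=
  dataMat x i n ω *ᵥ θ + fun k : Fin n => ξ i k ω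

/-- Local OLS estimator of agent `i` from its first `n` samples. -/
noncomputable def olsEst (V : Fin m → View d) (x : Fin m → ℕ → Ω → (Fin d → ℝ))
    (ξ : Fin m → ℕ → Ω → ℝ) (θ : Fin d → ℝ) (i : Fin m) (n : ℕ) (ω : Ω) :
    Fin (V i).obs → ℝ :=
  (V i).ols (dataMat x i n ω) (labels x ξ θ i n ω)

/-- Local imputation estimator of agent `i` from its first `n` samples. -/
noncomputable def impEst (V : Fin m → View d) (S : Matrix (Fin d) (Fin d) ℝ)
    (x : Fin m → ℕ → Ω → (Fin d → ℝ)) (ξ : Fin m → ℕ → Ω → ℝ) (θ : Fin d → ℝ)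
    (i : Fin m) (n : ℕ) (ω : Ω) : Fin d → ℝ :=
  (V i).imp S (dataMat x i n ω) (labels x ξ θ i n ω)

/-- Aggregated imputation estimator with weights `W` from `n` samples per agent. -/
noncomputable def aggEst (V : Fin m → View d) (S : Matrix (Fin d) (Fin d) ℝ)
    (W : Fin m → Matrix (Fin d) (Fin d) ℝ)
    (x : Fin m → ℕ → Ω → (Fin d → ℝ)) (ξ : Fin m → ℕ → Ω → ℝ) (θ : Fin d → ℝ)
    (n : ℕ) (ω : Ω) : Fin d → ℝ :=
  argmin (impLoss V S W fun i => impEst V S x ξ θ i n ω)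

end Samples

end CollabLS

open CollabLS

namespace CollabLS

/-! ### Moore–Penrose inverses of full-rank matrices -/

theorem IsMoorePenrose.pinv_eq {k l : Type*} [Fintype k] [Fintype l] [DecidableEq l]
    {A : Matrix k l ℝ} {B : Matrix l k ℝ} (h : IsMoorePenrose A B) : pinv A = B :=
  (pinv_spec A).unique h

theorem pinv_eq_of_isUnit_gram {k l : Type*} [Fintype k] [Fintype l] [DecidableEq l]
    {A : Matrix k l ℝ} (h : IsUnit (Aᵀ * A).det) : pinv A = (Aᵀ * A)⁻¹ * Aᵀ := by
  refine IsMoorePenrose.pinv_eq ⟨?_, ?_, ?_, ?_⟩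
  · rw [Matrix.mul_assoc, Matrix.mul_assoc, nonsing_inv_mul _ h, Matrix.mul_one]
  · rw [Matrix.mul_assoc _ Aᵀ A, nonsing_inv_mul _ h, Matrix.one_mul]
  · simp [Matrix.transpose_mul, transpose_nonsing_inv, Matrix.mul_assoc]
  · rw [Matrix.mul_assoc, nonsing_inv_mul _ h, transpose_one]

theorem pinv_transpose_mul_mul {k l : Type*} [Fintype k] [Fintype l] [DecidableEq k]
    [DecidableEq l] {G : Matrix k k ℝ} {T : Matrix k l ℝ} (hG : IsUnit G.det)
    (hT : IsUnit (T * Tᵀ).det) :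
    pinv (Tᵀ * G * T) = Tᵀ * (T * Tᵀ)⁻¹ * G⁻¹ * (T * Tᵀ)⁻¹ * T := by
  set H := T * Tᵀ with hH
  have hHs : Hᵀ = H := by simp [hH]
  have e1 : (Tᵀ * G * T) * (Tᵀ * H⁻¹ * G⁻¹ * H⁻¹ * T) = Tᵀ * H⁻¹ * T := by
    calc _ = Tᵀ * (G * (H * H⁻¹) * G⁻¹) * H⁻¹ * T := by rw [hH]; simp only [Matrix.mul_assoc]
      _ = _ := by rw [mul_nonsing_inv _ hT, Matrix.mul_one, mul_nonsing_inv _ hG, Matrix.mul_one]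
  have e2 : (Tᵀ * H⁻¹ * G⁻¹ * H⁻¹ * T) * (Tᵀ * G * T) = Tᵀ * H⁻¹ * T := by
    calc _ = Tᵀ * H⁻¹ * (G⁻¹ * (H⁻¹ * H) * G) * T := by rw [hH]; simp only [Matrix.mul_assoc]
      _ = _ := by rw [nonsing_inv_mul _ hT, Matrix.mul_one, nonsing_inv_mul _ hG, Matrix.mul_one]
  have hs : (Tᵀ * H⁻¹ * T)ᵀ = Tᵀ * H⁻¹ * T := by
    simp [transpose_nonsing_inv, hHs, Matrix.mul_assoc]
  refine IsMoorePenrose.pinv_eq ⟨?_, ?_, ?_, ?_⟩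
  · rw [e1]
    calc _ = Tᵀ * (H⁻¹ * H) * G * T := by rw [hH]; simp only [Matrix.mul_assoc]
      _ = _ := by rw [nonsing_inv_mul _ hT, Matrix.mul_one]
  · rw [e2]
    calc _ = Tᵀ * (H⁻¹ * H) * H⁻¹ * G⁻¹ * H⁻¹ * T := by rw [hH]; simp only [Matrix.mul_assoc]
      _ = _ := by rw [nonsing_inv_mul _ hT, Matrix.mul_one]
  · rw [e1, hs]
  · rw [e2, hs]

theorem rank_eq_card_iff_isUnit_gram {k l : Type*} [Fintype k] [Fintype l] [DecidableEq l]
    (A : Matrix k l ℝ) : A.rank = Fintype.card l ↔ IsUnit (Aᵀ * A).det := by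
  rw [← rank_transpose_mul_self, ← isUnit_iff_isUnit_det]
  refine ⟨fun h => ?_, fun h => rank_of_isUnit _ h⟩
  rw [← mulVec_surjective_iff_isUnit, ← coe_mulVecLin, ← LinearMap.range_eq_top]
  exact Submodule.eq_top_of_finrank_eq (by rw [Module.finrank_pi]; exact h)

/-! ### Linear algebra of views -/

namespace View

variable {d : ℕ} (V : View d)

theorem Pplus_mulVec (v : Fin d → ℝ) (a : Fin V.obs) :
    (V.Pplus *ᵥ v) a = v (V.perm (Sum.inl a)) := by
  simp [Pplus, mulVec, dotProduct]

theorem Pplus_mul_transpose : V.Pplus * V.Pplusᵀ = 1 := by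
  ext a b
  simp [Pplus, Matrix.mul_apply, Matrix.one_apply, eq_comm]

theorem Pplus_mul_Pminus_transpose : V.Pplus * V.Pminusᵀ = 0 := by
  ext a b
  simp [Pplus, Pminus, Matrix.mul_apply]

theorem transpose_mul_add : V.Pplusᵀ * V.Pplus + V.Pminusᵀ * V.Pminus = 1 := by
  ext i j
  obtain ⟨i, rfl⟩ := V.perm.surjective i
  obtain ⟨j, rfl⟩ := V.perm.surjective j
  rcases i with i | i <;> rcases j with j | j <;>
    simp [Pplus, Pminus, Matrix.mul_apply, Matrix.one_apply, eq_comm]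

theorem posDef_blockPlus {S : Matrix (Fin d) (Fin d) ℝ} (hS : S.PosDef) :
    (V.blockPlus S).PosDef := by
  have := hS.mul_mul_conjTranspose_same (B := V.Pplus) ?_
  · simpa [blockPlus] using this
  · intro v w h
    simpa [Matrix.vecMul_vecMul, Pplus_mul_transpose] using congrArg (fun u => u ᵥ* V.Pplusᵀ) h

variable {S : Matrix (Fin d) (Fin d) ℝ}

theorem isUnit_det_blockPlus (hS : S.PosDef) : IsUnit (V.blockPlus S).det :=
  (isUnit_iff_isUnit_det _).1 (V.posDef_blockPlus hS).isUnit

theorem blockPlus_transpose (hS : S.PosDef) : (V.blockPlus S)ᵀ = V.blockPlus S := by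
  simpa [IsHermitian] using (V.posDef_blockPlus hS).isHermitian

theorem T_eq_add : V.T S = V.Pplus + (V.blockPlus S)⁻¹ * V.blockPlusMinus S * V.Pminus := by
  rw [T, P, Matrix.fromCols_mul_fromRows, Matrix.one_mul]

theorem T_eq (hS : S.PosDef) : V.T S = (V.blockPlus S)⁻¹ * V.Pplus * S := by
  rw [T_eq_add]
  have h : V.Pplus * S = V.blockPlus S * V.Pplus + V.blockPlusMinus S * V.Pminus := by
    calc V.Pplus * S = V.Pplus * S * (V.Pplusᵀ * V.Pplus + V.Pminusᵀ * V.Pminus) := by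
          rw [transpose_mul_add, Matrix.mul_one]
      _ = _ := by simp only [blockPlus, blockPlusMinus, Matrix.mul_add, Matrix.mul_assoc]
  rw [Matrix.mul_assoc _ V.Pplus, h, Matrix.mul_add, ← Matrix.mul_assoc, ← Matrix.mul_assoc,
    nonsing_inv_mul _ (V.isUnit_det_blockPlus hS), Matrix.one_mul]

theorem T_mul_Pplus_transpose : V.T S * V.Pplusᵀ = 1 := by
  have : V.Pminus * V.Pplusᵀ = 0 := by
    simpa using congrArg transpose V.Pplus_mul_Pminus_transpose
  rw [T_eq_add, Matrix.add_mul, Pplus_mul_transpose, Matrix.mul_assoc, this, Matrix.mul_zero,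
    add_zero]

theorem isUnit_det_T_mul_transpose : IsUnit (V.T S * (V.T S)ᵀ).det := by
  have : (V.T S * (V.T S)ᵀ).PosDef := by
    have := PosDef.mul_conjTranspose_self (V.T S) ?_
    · simpa using this
    · intro v w h
      simpa [Matrix.vecMul_vecMul, T_mul_Pplus_transpose] using
        congrArg (fun u => u ᵥ* V.Pplusᵀ) h
  exact (isUnit_iff_isUnit_det _).1 this.isUnit

theorem T_mul_Tlift : V.T S * V.Tlift S = 1 := by
  rw [Tlift, ← Matrix.mul_assoc, mul_nonsing_inv _ V.isUnit_det_T_mul_transpose]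

theorem mulVec_eq_zero_of_T_mulVec_eq_zero (hS : S.PosDef) {v : Fin d → ℝ}
    (h : V.T S *ᵥ v = 0) (a : Fin V.obs) : (S *ᵥ v) (V.perm (Sum.inl a)) = 0 := by
  have h' : V.Pplus *ᵥ (S *ᵥ v) = 0 := by
    have := congrArg (fun u => V.blockPlus S *ᵥ u) h
    simpa [V.T_eq hS, Matrix.mulVec_mulVec, ← Matrix.mul_assoc,
      mul_nonsing_inv _ (V.isUnit_det_blockPlus hS)] using this
  rw [← V.Pplus_mulVec (S *ᵥ v) a, h', Pi.zero_apply]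

/-- Under full column rank, imputation is `Tᵀ (T Tᵀ)⁻¹ (X₊ᵀ X₊)⁻¹ X₊ᵀ y`. -/
theorem imp_eq_Tlift_mulVec {n : ℕ} (X : Matrix (Fin n) (Fin d) ℝ) (y : Fin n → ℝ)
    (h : IsUnit ((V.dataPlus X)ᵀ * V.dataPlus X).det) :
    V.imp S X y =
      V.Tlift S *ᵥ (((V.dataPlus X)ᵀ * V.dataPlus X)⁻¹ *ᵥ ((V.dataPlus X)ᵀ *ᵥ y)) := by
  have e := pinv_transpose_mul_mul h (V.isUnit_det_T_mul_transpose (S := S))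
  rw [imp, Matrix.mul_assoc (V.T S)ᵀ, e]
  simp only [Matrix.mulVec_mulVec, Tlift]
  congr 1
  set H := V.T S * (V.T S)ᵀ with hH
  set G := (V.dataPlus X)ᵀ * V.dataPlus X
  calc _ = (V.T S)ᵀ * H⁻¹ * G⁻¹ * (H⁻¹ * H) * (V.dataPlus X)ᵀ := by
        rw [hH]; simp only [Matrix.mul_assoc]
    _ = _ := by
        rw [nonsing_inv_mul _ V.isUnit_det_T_mul_transpose, Matrix.mul_one]
        simp only [Matrix.mul_assoc]

theorem imp_eq_Tlift_mulVec_ols {n : ℕ} (X : Matrix (Fin n) (Fin d) ℝ) (y : Fin n → ℝ)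
    (h : IsUnit ((V.dataPlus X)ᵀ * V.dataPlus X).det) :
    V.imp S X y = V.Tlift S *ᵥ V.ols X y := by
  rw [V.imp_eq_Tlift_mulVec X y h, ols, pinv_eq_of_isUnit_gram h, ← Matrix.mulVec_mulVec]

end View

/-! ### Weights and aggregation -/

section Aggregation

variable {d m : ℕ} {V : Fin m → View d} {S : Matrix (Fin d) (Fin d) ℝ}

theorem eq_zero_of_forall_T_mulVec_eq_zero
    (hcover : ∀ j : Fin d, ∃ i : Fin m, ∃ a : Fin (V i).obs, (V i).perm (Sum.inl a) = j)
    (hS : S.PosDef) {v : Fin d → ℝ} (h : ∀ i, (V i).T S *ᵥ v = 0) : v = 0 := by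
  have hSv : S *ᵥ v = 0 := by
    funext j
    obtain ⟨i, a, rfl⟩ := hcover j
    exact (V i).mulVec_eq_zero_of_T_mulVec_eq_zero hS (h i) a
  exact (mulVec_injective_iff_isUnit.2 hS.isUnit) (by simpa using hSv)

theorem posDef_sum_transpose_mul_mul {κ : Type*} [Fintype κ] {l : κ → Type*}
    [∀ i, Fintype (l i)] {k : Type*} [Fintype k]
    {A : (i : κ) → Matrix (l i) k ℝ} {W : (i : κ) → Matrix (l i) (l i) ℝ}
    (hW : ∀ i, (W i).PosDef) (hA : ∀ v, (∀ i, A i *ᵥ v = 0) → v = 0) :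
    (∑ i, (A i)ᵀ * W i * A i).PosDef := by
  have hpsd : ∀ i, ((A i)ᵀ * W i * A i).PosSemidef := fun i => by
    simpa using (hW i).posSemidef.conjTranspose_mul_mul_same (A i)
  refine .of_dotProduct_mulVec_pos (posSemidef_sum _ fun i _ => hpsd i).isHermitian fun v hv => ?_
  have hq : ∀ i, v ⬝ᵥ (((A i)ᵀ * W i * A i) *ᵥ v) = (A i *ᵥ v) ⬝ᵥ (W i *ᵥ (A i *ᵥ v)) := fun i => by
    simp only [← Matrix.mulVec_mulVec, Matrix.dotProduct_mulVec, Matrix.vecMul_transpose]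
  simp only [star_trivial, Matrix.sum_mulVec, dotProduct_sum, hq]
  obtain ⟨i, hi⟩ : ∃ i, A i *ᵥ v ≠ 0 := by
    by_contra! h
    exact hv (hA v h)
  refine Finset.sum_pos' (fun j _ => ?_) ⟨i, Finset.mem_univ i, ?_⟩
  · simpa using (hW j).posSemidef.dotProduct_mulVec_nonneg (A j *ᵥ v)
  · simpa using (hW i).dotProduct_mulVec_pos hi

theorem admissible_of_posDef
    (hcover : ∀ j : Fin d, ∃ i : Fin m, ∃ a : Fin (V i).obs, (V i).perm (Sum.inl a) = j)
    (hS : S.PosDef) {W : Fin m → Matrix (Fin d) (Fin d) ℝ} (hW : ∀ i, (W i).PosDef) :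
    Admissible V S W := by
  refine ⟨fun i => (hW i).posSemidef, posDef_sum_transpose_mul_mul hW fun v hv => ?_⟩
  refine eq_zero_of_forall_T_mulVec_eq_zero hcover hS fun i => ?_
  have := congrArg (fun u => (V i).T S *ᵥ u) (hv i)
  simpa [Matrix.mulVec_mulVec, ← Matrix.mul_assoc, View.T_mul_Tlift] using this

theorem posDef_sum_T_transpose_mul_mul_T
    (hcover : ∀ j : Fin d, ∃ i : Fin m, ∃ a : Fin (V i).obs, (V i).perm (Sum.inl a) = j)
    (hS : S.PosDef) {U : (i : Fin m) → Matrix (Fin (V i).obs) (Fin (V i).obs) ℝ}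
    (hU : ∀ i, (U i).PosDef) :
    (∑ i, ((V i).T S)ᵀ * U i * (V i).T S).PosDef :=
  posDef_sum_transpose_mul_mul hU fun _ hv => eq_zero_of_forall_T_mulVec_eq_zero hcover hS hv

theorem projection_sandwich (V : View d) (U : Matrix (Fin V.obs) (Fin V.obs) ℝ) :
    (V.Tlift S * V.T S)ᵀ * ((V.T S)ᵀ * U * V.T S) * (V.Tlift S * V.T S) =
      (V.T S)ᵀ * U * V.T S := by
  have h : V.T S * (V.Tlift S * V.T S) = V.T S := by
    rw [← Matrix.mul_assoc, View.T_mul_Tlift, Matrix.one_mul]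
  have h' : (V.Tlift S * V.T S)ᵀ * (V.T S)ᵀ = (V.T S)ᵀ := by
    rw [← Matrix.transpose_mul, h]
  calc _ = ((V.Tlift S * V.T S)ᵀ * (V.T S)ᵀ) * U * (V.T S * (V.Tlift S * V.T S)) := by
        simp only [Matrix.mul_assoc]
    _ = _ := by rw [h, h']

theorem admissible_T_transpose_mul_mul_T
    (hcover : ∀ j : Fin d, ∃ i : Fin m, ∃ a : Fin (V i).obs, (V i).perm (Sum.inl a) = j)
    (hS : S.PosDef) {U : (i : Fin m) → Matrix (Fin (V i).obs) (Fin (V i).obs) ℝ}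
    (hU : ∀ i, (U i).PosDef) :
    Admissible V S fun i => ((V i).T S)ᵀ * U i * (V i).T S := by
  refine ⟨fun i => ?_, ?_⟩
  · simpa using (hU i).posSemidef.conjTranspose_mul_mul_same ((V i).T S)
  · simpa only [projection_sandwich] using posDef_sum_T_transpose_mul_mul_T hcover hS hU

/-- The quadratic part of the aggregation loss. -/
noncomputable def impHess (V : Fin m → View d) (S : Matrix (Fin d) (Fin d) ℝ)
    (W : Fin m → Matrix (Fin d) (Fin d) ℝ) : Matrix (Fin d) (Fin d) ℝ :=
  ∑ i, ((V i).Tlift S * (V i).T S)ᵀ * W i * ((V i).Tlift S * (V i).T S)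

/-- The minimizer of the aggregation loss, in closed form. -/
noncomputable def aggSol (V : Fin m → View d) (S : Matrix (Fin d) (Fin d) ℝ)
    (W : Fin m → Matrix (Fin d) (Fin d) ℝ) (β : Fin m → Fin d → ℝ) : Fin d → ℝ :=
  (impHess V S W)⁻¹ *ᵥ ∑ i, (((V i).Tlift S * (V i).T S)ᵀ * W i) *ᵥ β i

theorem Admissible.posDef_impHess {W : Fin m → Matrix (Fin d) (Fin d) ℝ}
    (hW : Admissible V S W) : (impHess V S W).PosDef :=
  hW.2

theorem Admissible.isUnit_det {W : Fin m → Matrix (Fin d) (Fin d) ℝ} (hW : Admissible V S W) :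
    IsUnit (impHess V S W).det :=
  (isUnit_iff_isUnit_det _).1 hW.posDef_impHess.isUnit

theorem Admissible.transpose_eq {W : Fin m → Matrix (Fin d) (Fin d) ℝ} (hW : Admissible V S W)
    (i : Fin m) : (W i)ᵀ = W i := by
  simpa [IsHermitian] using (hW.1 i).isHermitian

theorem Admissible.impLoss_eq {W : Fin m → Matrix (Fin d) (Fin d) ℝ} (hW : Admissible V S W)
    (β : Fin m → Fin d → ℝ) (t : Fin d → ℝ) :
    impLoss V S W β t = impLoss V S W β (aggSol V S W β) +
      (t - aggSol V S W β) ⬝ᵥ (impHess V S W *ᵥ (t - aggSol V S W β)) := by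
  set s := aggSol V S W β with hs
  set h := t - s with hh
  have ht : t = s + h := by simp [hh]
  have key : ∑ i, (((V i).Tlift S * (V i).T S)ᵀ * W i) *ᵥ
      (((V i).Tlift S * (V i).T S) *ᵥ s - β i) = 0 := by
    simp only [Matrix.mulVec_sub, Finset.sum_sub_distrib, Matrix.mulVec_mulVec]
    rw [← Matrix.sum_mulVec, hs, aggSol, Matrix.mulVec_mulVec]
    change (impHess V S W * (impHess V S W)⁻¹) *ᵥ _ - _ = 0
    rw [mul_nonsing_inv _ hW.isUnit_det, Matrix.one_mulVec, sub_self]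
  have hcross : ∑ i, (((V i).Tlift S * (V i).T S) *ᵥ h) ⬝ᵥ
      (W i *ᵥ (((V i).Tlift S * (V i).T S) *ᵥ s - β i)) = 0 := by
    have := congrArg (fun u => h ⬝ᵥ u) key
    simpa only [dotProduct_sum, ← Matrix.mulVec_mulVec, Matrix.dotProduct_mulVec _ (_ᵀ),
      Matrix.vecMul_transpose, dotProduct_zero] using this
  have hterm : ∀ i, (((V i).Tlift S * (V i).T S) *ᵥ t - β i) ⬝ᵥ
      (W i *ᵥ (((V i).Tlift S * (V i).T S) *ᵥ t - β i)) =
      (((V i).Tlift S * (V i).T S) *ᵥ s - β i) ⬝ᵥ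
        (W i *ᵥ (((V i).Tlift S * (V i).T S) *ᵥ s - β i)) +
      h ⬝ᵥ ((((V i).Tlift S * (V i).T S)ᵀ * W i * ((V i).Tlift S * (V i).T S)) *ᵥ h) +
      2 * ((((V i).Tlift S * (V i).T S) *ᵥ h) ⬝ᵥ
        (W i *ᵥ (((V i).Tlift S * (V i).T S) *ᵥ s - β i))) := by
    intro i
    set Q := (V i).Tlift S * (V i).T S
    have e : Q *ᵥ t - β i = (Q *ᵥ s - β i) + Q *ᵥ h := by rw [ht, Matrix.mulVec_add]; abel
    have e2 : h ⬝ᵥ ((Qᵀ * W i * Q) *ᵥ h) = (Q *ᵥ h) ⬝ᵥ (W i *ᵥ (Q *ᵥ h)) := by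
      simp only [← Matrix.mulVec_mulVec, Matrix.dotProduct_mulVec, Matrix.vecMul_transpose]
    have e3 : (Q *ᵥ s - β i) ⬝ᵥ (W i *ᵥ (Q *ᵥ h)) = (Q *ᵥ h) ⬝ᵥ (W i *ᵥ (Q *ᵥ s - β i)) := by
      rw [Matrix.dotProduct_mulVec, dotProduct_comm, ← Matrix.mulVec_transpose, hW.transpose_eq]
    rw [e, e2, Matrix.mulVec_add, dotProduct_add, add_dotProduct, add_dotProduct, e3]
    ring
  rw [impLoss, Finset.sum_congr rfl fun i _ => hterm i, Finset.sum_add_distrib,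
    Finset.sum_add_distrib, ← Finset.mul_sum, hcross, mul_zero, add_zero, impLoss, impHess,
    Matrix.sum_mulVec, dotProduct_sum]

theorem Admissible.impLoss_aggSol_le {W : Fin m → Matrix (Fin d) (Fin d) ℝ}
    (hW : Admissible V S W) (β : Fin m → Fin d → ℝ) (t : Fin d → ℝ) :
    impLoss V S W β (aggSol V S W β) ≤ impLoss V S W β t := by
  rw [hW.impLoss_eq β t]
  exact le_add_of_nonneg_right
    (hW.posDef_impHess.posSemidef.dotProduct_mulVec_nonneg (t - aggSol V S W β))

theorem Admissible.existsUnique_minimizer {W : Fin m → Matrix (Fin d) (Fin d) ℝ}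
    (hW : Admissible V S W) (β : Fin m → Fin d → ℝ) :
    ∃! t : Fin d → ℝ, ∀ t', impLoss V S W β t ≤ impLoss V S W β t' := by
  refine ⟨aggSol V S W β, hW.impLoss_aggSol_le β, fun t ht => ?_⟩
  by_contra hne
  have h1 := ht (aggSol V S W β)
  rw [hW.impLoss_eq β t] at h1
  have h2 := hW.posDef_impHess.dotProduct_mulVec_pos (sub_ne_zero.2 hne)
  rw [star_trivial] at h2
  exact absurd h1 (not_le.2 (lt_add_of_pos_right _ h2))

theorem Admissible.argmin_impLoss {W : Fin m → Matrix (Fin d) (Fin d) ℝ}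
    (hW : Admissible V S W) (β : Fin m → Fin d → ℝ) :
    argmin (impLoss V S W β) = aggSol V S W β := by
  have h1 := Classical.epsilon_spec (hW.existsUnique_minimizer β).exists
  exact (hW.existsUnique_minimizer β).unique h1 (hW.impLoss_aggSol_le β)

/-- The matrix by which the error of the local regression of agent `i` enters the aggregate. -/
noncomputable def aggGain (V : Fin m → View d) (S : Matrix (Fin d) (Fin d) ℝ)
    (W : Fin m → Matrix (Fin d) (Fin d) ℝ) (i : Fin m) : Matrix (Fin d) (Fin (V i).obs) ℝ :=
  (impHess V S W)⁻¹ * (((V i).Tlift S * (V i).T S)ᵀ * W i) * (V i).Tlift S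

theorem Admissible.sum_aggGain_mul_T {W : Fin m → Matrix (Fin d) (Fin d) ℝ}
    (hW : Admissible V S W) : ∑ i, aggGain V S W i * (V i).T S = 1 := by
  calc ∑ i, aggGain V S W i * (V i).T S
      = ∑ i, (impHess V S W)⁻¹ *
          (((V i).Tlift S * (V i).T S)ᵀ * W i * ((V i).Tlift S * (V i).T S)) :=
        Finset.sum_congr rfl fun i _ => by simp only [aggGain, Matrix.mul_assoc]
    _ = (impHess V S W)⁻¹ * impHess V S W := by rw [← Finset.mul_sum]; rfl
    _ = 1 := nonsing_inv_mul _ hW.isUnit_det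

theorem Admissible.aggSol_sub {W : Fin m → Matrix (Fin d) (Fin d) ℝ} (hW : Admissible V S W)
    (β : (i : Fin m) → Fin (V i).obs → ℝ) (θ : Fin d → ℝ) :
    aggSol V S W (fun i => (V i).Tlift S *ᵥ β i) - θ =
      ∑ i, aggGain V S W i *ᵥ (β i - (V i).T S *ᵥ θ) := by
  have h1 : aggSol V S W (fun i => (V i).Tlift S *ᵥ β i) = ∑ i, aggGain V S W i *ᵥ β i := by
    rw [aggSol, Matrix.mulVec_sum]
    refine Finset.sum_congr rfl fun i _ => ?_
    rw [Matrix.mulVec_mulVec, Matrix.mulVec_mulVec, aggGain, ← Matrix.mul_assoc]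
  have h2 : ∑ i, aggGain V S W i *ᵥ ((V i).T S *ᵥ θ) = θ := by
    simp only [Matrix.mulVec_mulVec]
    rw [← Matrix.sum_mulVec, hW.sum_aggGain_mul_T, Matrix.one_mulVec]
  simp only [Matrix.mulVec_sub, Finset.sum_sub_distrib]
  rw [h1, h2]

/-- Asymptotic covariance of the aggregate when agent `i` has the covariance `(U i)⁻¹`. -/
noncomputable def aggCov (V : Fin m → View d) (S : Matrix (Fin d) (Fin d) ℝ)
    (U : (i : Fin m) → Matrix (Fin (V i).obs) (Fin (V i).obs) ℝ)
    (W : Fin m → Matrix (Fin d) (Fin d) ℝ) : Matrix (Fin d) (Fin d) ℝ :=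
  ∑ i, aggGain V S W i * (U i)⁻¹ * (aggGain V S W i)ᵀ

theorem posSemidef_aggCov {U : (i : Fin m) → Matrix (Fin (V i).obs) (Fin (V i).obs) ℝ}
    (hU : ∀ i, (U i).PosDef) (W : Fin m → Matrix (Fin d) (Fin d) ℝ) :
    (aggCov V S U W).PosSemidef :=
  posSemidef_sum _ fun i _ => by
    simpa using (hU i).inv.posSemidef.mul_mul_conjTranspose_same (aggGain V S W i)

/-- Gauss–Markov: among left inverses `L` of the stacked `A`, the covariance `∑ L U⁻¹ Lᵀ` is
minimal at the weighted least squares solution. -/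
theorem posSemidef_gauss_markov {κ : Type*} [Fintype κ] {l : κ → Type*} [∀ i, Fintype (l i)]
    [∀ i, DecidableEq (l i)] {k : Type*} [Fintype k] [DecidableEq k]
    {A : (i : κ) → Matrix (l i) k ℝ} {L : (i : κ) → Matrix k (l i) ℝ}
    {U : (i : κ) → Matrix (l i) (l i) ℝ} (hU : ∀ i, (U i).PosDef)
    (hM : (∑ i, (A i)ᵀ * U i * A i).PosDef) (hL : ∑ i, L i * A i = 1) :
    (∑ i, L i * (U i)⁻¹ * (L i)ᵀ - (∑ i, (A i)ᵀ * U i * A i)⁻¹).PosSemidef := by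
  set M := ∑ i, (A i)ᵀ * U i * A i with hMdef
  have hMu : IsUnit M.det := (isUnit_iff_isUnit_det _).1 hM.isUnit
  have hMs : Mᵀ = M := by simpa [IsHermitian] using hM.isHermitian
  have hLt : ∑ i, (A i)ᵀ * (L i)ᵀ = 1 := by
    simpa [Matrix.transpose_sum, Matrix.transpose_mul] using congrArg transpose hL
  have key : ∑ i, L i * (U i)⁻¹ * (L i)ᵀ - M⁻¹ =
      ∑ i, (L i - M⁻¹ * (A i)ᵀ * U i) * (U i)⁻¹ * (L i - M⁻¹ * (A i)ᵀ * U i)ᵀ := by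
    have hterm : ∀ i, (L i - M⁻¹ * (A i)ᵀ * U i) * (U i)⁻¹ * (L i - M⁻¹ * (A i)ᵀ * U i)ᵀ =
        L i * (U i)⁻¹ * (L i)ᵀ - M⁻¹ * ((A i)ᵀ * (L i)ᵀ) - (L i * A i) * M⁻¹ +
          M⁻¹ * ((A i)ᵀ * U i * A i) * M⁻¹ := by
      intro i
      have hu : IsUnit (U i).det := (isUnit_iff_isUnit_det _).1 (hU i).isUnit
      have hs : (U i)ᵀ = U i := by simpa [IsHermitian] using (hU i).isHermitian
      simp only [Matrix.transpose_sub, Matrix.transpose_mul, transpose_nonsing_inv, hMs, hs,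
        Matrix.transpose_transpose, Matrix.sub_mul, Matrix.mul_sub]
      have c1 : (U i)⁻¹ * U i = 1 := nonsing_inv_mul _ hu
      have c2 : U i * (U i)⁻¹ = 1 := mul_nonsing_inv _ hu
      have e1 : M⁻¹ * (A i)ᵀ * U i * (U i)⁻¹ = M⁻¹ * (A i)ᵀ := by
        rw [Matrix.mul_assoc, c2, Matrix.mul_one]
      have e2 : L i * (U i)⁻¹ * (U i * (A i * M⁻¹)) = L i * A i * M⁻¹ := by
        rw [← Matrix.mul_assoc, Matrix.mul_assoc (L i), c1, Matrix.mul_one, Matrix.mul_assoc]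
      rw [e1, e2]
      simp only [Matrix.mul_assoc]
      abel
    simp only [hterm, Finset.sum_add_distrib, Finset.sum_sub_distrib, ← Finset.mul_sum,
      ← Finset.sum_mul, hL, hLt, Matrix.mul_one, Matrix.one_mul]
    rw [← hMdef, nonsing_inv_mul _ hMu, Matrix.one_mul]
    abel
  rw [key]
  exact posSemidef_sum _ fun i _ => by
    simpa only [conjTranspose_eq_transpose_of_trivial] using
      (hU i).inv.posSemidef.mul_mul_conjTranspose_same (L i - M⁻¹ * (A i)ᵀ * U i)

theorem Admissible.posSemidef_aggCov_sub {W : Fin m → Matrix (Fin d) (Fin d) ℝ}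
    (hW : Admissible V S W) {U : (i : Fin m) → Matrix (Fin (V i).obs) (Fin (V i).obs) ℝ}
    (hU : ∀ i, (U i).PosDef) (hM : (∑ i, ((V i).T S)ᵀ * U i * (V i).T S).PosDef) :
    (aggCov V S U W - (∑ i, ((V i).T S)ᵀ * U i * (V i).T S)⁻¹).PosSemidef :=
  posSemidef_gauss_markov hU hM hW.sum_aggGain_mul_T

theorem aggCov_T_transpose_mul_mul_T
    {U : (i : Fin m) → Matrix (Fin (V i).obs) (Fin (V i).obs) ℝ}
    (hU : ∀ i, (U i).PosDef) (hM : (∑ i, ((V i).T S)ᵀ * U i * (V i).T S).PosDef) :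
    aggCov V S U (fun i => ((V i).T S)ᵀ * U i * (V i).T S) =
      (∑ i, ((V i).T S)ᵀ * U i * (V i).T S)⁻¹ := by
  set M := ∑ i, ((V i).T S)ᵀ * U i * (V i).T S with hMdef
  have hMu : IsUnit M.det := (isUnit_iff_isUnit_det _).1 hM.isUnit
  have hMs : Mᵀ = M := by simpa [IsHermitian] using hM.isHermitian
  have hH : impHess V S (fun i => ((V i).T S)ᵀ * U i * (V i).T S) = M := by
    simp only [impHess, projection_sandwich, hMdef]
  have hgain : ∀ i, aggGain V S (fun i => ((V i).T S)ᵀ * U i * (V i).T S) i =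
      M⁻¹ * ((V i).T S)ᵀ * U i := by
    intro i
    have h' : ((V i).Tlift S * (V i).T S)ᵀ * ((V i).T S)ᵀ = ((V i).T S)ᵀ := by
      rw [← Matrix.transpose_mul, ← Matrix.mul_assoc, View.T_mul_Tlift, Matrix.one_mul]
    rw [aggGain, hH]
    calc _ = M⁻¹ * (((V i).Tlift S * (V i).T S)ᵀ * ((V i).T S)ᵀ) * U i *
          ((V i).T S * (V i).Tlift S) := by simp only [Matrix.mul_assoc]
      _ = _ := by rw [h', View.T_mul_Tlift, Matrix.mul_one]
  have hterm : ∀ i, M⁻¹ * ((V i).T S)ᵀ * U i * (U i)⁻¹ * (M⁻¹ * ((V i).T S)ᵀ * U i)ᵀ =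
      M⁻¹ * (((V i).T S)ᵀ * U i * (V i).T S) * M⁻¹ := by
    intro i
    have hu : IsUnit (U i).det := (isUnit_iff_isUnit_det _).1 (hU i).isUnit
    have hs : (U i)ᵀ = U i := by simpa [IsHermitian] using (hU i).isHermitian
    rw [Matrix.mul_assoc _ (U i), mul_nonsing_inv _ hu]
    simp [transpose_nonsing_inv, hMs, hs, Matrix.mul_assoc]
  simp only [aggCov, hgain, hterm, ← Finset.mul_sum, ← Finset.sum_mul]
  rw [← hMdef, nonsing_inv_mul _ hMu, Matrix.one_mul]

end Aggregation

/-! ### Measurability of the Moore–Penrose inverse -/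

theorem measurable_of_isClosed_graph {X Y : Type*} [TopologicalSpace X] [MeasurableSpace X]
    [BorelSpace X] [T2Space X] [SigmaCompactSpace X] [TopologicalSpace Y] [MeasurableSpace Y]
    [BorelSpace Y] [SigmaCompactSpace Y] {f : X → Y}
    (hf : IsClosed {p : X × Y | p.2 = f p.1}) : Measurable f := by
  refine measurable_of_isClosed fun C hC => ?_
  have h : f ⁻¹' C = Prod.fst '' ({p : X × Y | p.2 = f p.1} ∩ Prod.snd ⁻¹' C) := by
    ext x
    simp
  obtain ⟨K, hK, hKU⟩ : IsSigmaCompact (f ⁻¹' C) := by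
    rw [h]
    exact (isSigmaCompact_univ.of_isClosed_subset (hf.inter (hC.preimage continuous_snd))
      (Set.subset_univ _)).image continuous_fst
  rw [← hKU]
  exact MeasurableSet.iUnion fun n => (hK n).isClosed.measurableSet

theorem measurable_pinv {k l : Type*} [Fintype k] [Fintype l] [DecidableEq l] :
    Measurable fun (A : k → l → ℝ) (i : l) (j : k) => pinv (Matrix.of A) i j := by
  refine measurable_of_isClosed_graph ?_
  have h : {p : (k → l → ℝ) × (l → k → ℝ) | p.2 = fun i j => pinv (Matrix.of p.1) i j} =
      {p | Matrix.of p.1 * Matrix.of p.2 * Matrix.of p.1 = Matrix.of p.1} ∩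
      {p | Matrix.of p.2 * Matrix.of p.1 * Matrix.of p.2 = Matrix.of p.2} ∩
      {p | (Matrix.of p.1 * Matrix.of p.2)ᵀ = Matrix.of p.1 * Matrix.of p.2} ∩
      {p | (Matrix.of p.2 * Matrix.of p.1)ᵀ = Matrix.of p.2 * Matrix.of p.1} := by
    ext p
    constructor
    · rintro (hp : p.2 = _)
      have := pinv_spec (Matrix.of p.1)
      have hp' : Matrix.of p.2 = pinv (Matrix.of p.1) := hp
      simp only [Set.mem_inter_iff, Set.mem_ofPred_eq, hp']
      exact ⟨⟨⟨this.1, this.2⟩, this.3⟩, this.4⟩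
    · rintro ⟨⟨⟨h1, h2⟩, h3⟩, h4⟩
      exact (IsMoorePenrose.pinv_eq ⟨h1, h2, h3, h4⟩).symm
  have c1 : Continuous fun p : (k → l → ℝ) × (l → k → ℝ) => (Matrix.of p.1 : Matrix k l ℝ) :=
    continuous_fst
  have c2 : Continuous fun p : (k → l → ℝ) × (l → k → ℝ) => (Matrix.of p.2 : Matrix l k ℝ) :=
    continuous_snd
  rw [h]
  have c12 := c1.matrix_mul c2
  have c21 := c2.matrix_mul c1
  exact (((isClosed_eq (c12.matrix_mul c1) c1).inter (isClosed_eq (c21.matrix_mul c2) c2)).inter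
    (isClosed_eq c12.matrix_transpose c12)).inter (isClosed_eq c21.matrix_transpose c21)

section Probability

variable {Ω : Type*} [MeasurableSpace Ω] {Pr : Measure Ω}

theorem aemeasurable_pinv {k l : Type*} [Fintype k] [Fintype l] [DecidableEq l]
    {A : Ω → Matrix k l ℝ} (hA : ∀ i j, AEMeasurable (fun ω => A ω i j) Pr) (i : l) (j : k) :
    AEMeasurable (fun ω => pinv (A ω) i j) Pr := by
  have h1 : AEMeasurable (fun ω i j => A ω i j) Pr :=
    aemeasurable_pi_lambda _ fun i => aemeasurable_pi_lambda _ fun j => hA i j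
  have h2 := measurable_pinv.comp_aemeasurable h1
  exact aemeasurable_pi_iff.1 (aemeasurable_pi_iff.1 h2 i) j

theorem aemeasurable_mulVec {k l : Type*} [Fintype l] {A : Ω → Matrix k l ℝ} {v : Ω → l → ℝ}
    (hA : ∀ i j, AEMeasurable (fun ω => A ω i j) Pr) (hv : ∀ j, AEMeasurable (fun ω => v ω j) Pr)
    (i : k) : AEMeasurable (fun ω => (A ω *ᵥ v ω) i) Pr := by
  simp only [mulVec, dotProduct]
  exact Finset.aemeasurable_fun_sum _ fun j _ => (hA i j).mul (hv j)

theorem aemeasurable_matrix_mul {k l o : Type*} [Fintype l] {A : Ω → Matrix k l ℝ}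
    {B : Ω → Matrix l o ℝ} (hA : ∀ i j, AEMeasurable (fun ω => A ω i j) Pr)
    (hB : ∀ i j, AEMeasurable (fun ω => B ω i j) Pr) (i : k) (j : o) :
    AEMeasurable (fun ω => (A ω * B ω) i j) Pr := by
  simp only [Matrix.mul_apply]
  exact Finset.aemeasurable_fun_sum _ fun r _ => (hA i r).mul (hB r j)

theorem pinv_eq_inv {l : Type*} [Fintype l] [DecidableEq l] {A : Matrix l l ℝ}
    (h : IsUnit A.det) : pinv A = A⁻¹ := by
  refine IsMoorePenrose.pinv_eq ⟨?_, ?_, ?_, ?_⟩ <;>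
    simp [mul_nonsing_inv _ h, nonsing_inv_mul _ h]

theorem tendsto_pinv_of_isUnit {l : Type*} [Fintype l] [DecidableEq l]
    {A : ℕ → Matrix l l ℝ} {B : Matrix l l ℝ} (hB : IsUnit B.det)
    (h : Tendsto A atTop (𝓝 B)) :
    (∀ᶠ n in atTop, IsUnit (A n).det) ∧ Tendsto (fun n => pinv (A n)) atTop (𝓝 B⁻¹) := by
  have hdet : Tendsto (fun n => (A n).det) atTop (𝓝 B.det) :=
    (continuous_id.matrix_det.tendsto B).comp h
  have hev : ∀ᶠ n in atTop, IsUnit (A n).det :=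
    (hdet.eventually_ne hB.ne_zero).mono fun n hn => isUnit_iff_ne_zero.2 hn
  refine ⟨hev, ?_⟩
  have hadj : Tendsto (fun n => (A n).adjugate) atTop (𝓝 B.adjugate) :=
    (continuous_id.matrix_adjugate.tendsto B).comp h
  have hlim := (hdet.inv₀ hB.ne_zero).smul hadj
  rw [Matrix.inv_def, Ring.inverse_eq_inv']
  refine hlim.congr' (hev.mono fun n hn => ?_)
  rw [← Ring.inverse_eq_inv', ← Matrix.inv_def]
  exact (pinv_eq_inv hn).symm

/-! ### Central limit theorem for independent groups of i.i.d. vectors -/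

theorem dotProduct_blockDiagonal'_mulVec {κ : Type*} [Fintype κ] [DecidableEq κ] {l : κ → Type*}
    [∀ i, Fintype (l i)] (Q : (i : κ) → Matrix (l i) (l i) ℝ) (v w : (Σ i, l i) → ℝ) :
    v ⬝ᵥ (blockDiagonal' Q *ᵥ w) =
      ∑ i, (fun a => v ⟨i, a⟩) ⬝ᵥ (Q i *ᵥ fun a => w ⟨i, a⟩) := by
  simp only [dotProduct, mulVec, Fintype.sum_sigma]
  refine Finset.sum_congr rfl fun i _ => Finset.sum_congr rfl fun a _ => ?_
  rw [Finset.sum_eq_single i]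
  · simp [blockDiagonal'_apply_eq]
  · intro j _ hj
    exact Finset.sum_eq_zero fun b _ => by rw [blockDiagonal'_apply_ne _ _ _ hj.symm, zero_mul]
  · simp

theorem posSemidef_blockDiagonal' {κ : Type*} [Fintype κ] [DecidableEq κ] {l : κ → Type*}
    [∀ i, Fintype (l i)] {Q : (i : κ) → Matrix (l i) (l i) ℝ} (hQ : ∀ i, (Q i).PosSemidef) :
    (blockDiagonal' Q).PosSemidef := by
  refine .of_dotProduct_mulVec_nonneg ?_ fun v => ?_
  · rw [IsHermitian, blockDiagonal'_conjTranspose]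
    exact congrArg _ (funext fun i => (hQ i).isHermitian)
  · rw [star_trivial, dotProduct_blockDiagonal'_mulVec]
    exact Finset.sum_nonneg fun i _ => by
      simpa using (hQ i).dotProduct_mulVec_nonneg (fun a => v ⟨i, a⟩)

theorem charFun_map_eq_charFun_inner {E : Type*} [NormedAddCommGroup E] [InnerProductSpace ℝ E]
    [MeasurableSpace E] [BorelSpace E] [SecondCountableTopology E] {Y : Ω → E}
    (hY : AEMeasurable Y Pr) (t : E) :
    charFun (Pr.map Y) t = charFun (Pr.map fun ω => inner ℝ (Y ω) t) 1 := by
  rw [charFun_apply, charFun_apply_real, integral_map hY (by fun_prop),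
    integral_map (by fun_prop) (by fun_prop)]
  simp

theorem map_mulVec_multivariateGaussian {ι κ : Type*} [Fintype ι] [DecidableEq ι] [Fintype κ]
    [DecidableEq κ] {K : Matrix ι ι ℝ} (hK : K.PosSemidef) (A : Matrix κ ι ℝ) :
    (multivariateGaussian 0 K).map
        (fun z => (WithLp.toLp 2 (A *ᵥ WithLp.ofLp z) : EuclideanSpace ℝ κ)) =
      multivariateGaussian 0 (A * K * Aᵀ) := by
  have hc : Continuous fun z : EuclideanSpace ℝ ι =>
      (WithLp.toLp 2 (A *ᵥ WithLp.ofLp z) : EuclideanSpace ℝ κ) :=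
    (PiLp.continuous_toLp 2 _).comp
      (continuous_const.matrix_mulVec (PiLp.continuous_ofLp 2 _))
  have hAK : (A * K * Aᵀ).PosSemidef := by simpa using hK.mul_mul_conjTranspose_same A
  have := Measure.isProbabilityMeasure_map (μ := multivariateGaussian 0 K) hc.aemeasurable
  refine Measure.ext_of_charFun ?_
  ext t
  have hinner : ∀ z : EuclideanSpace ℝ ι,
      inner ℝ (WithLp.toLp 2 (A *ᵥ WithLp.ofLp z) : EuclideanSpace ℝ κ) t =
        inner ℝ z (WithLp.toLp 2 (Aᵀ *ᵥ WithLp.ofLp t) : EuclideanSpace ℝ ι) := fun z => by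
    have h : (A *ᵥ WithLp.ofLp z) ⬝ᵥ WithLp.ofLp t =
        WithLp.ofLp z ⬝ᵥ (Aᵀ *ᵥ WithLp.ofLp t) := by
      rw [Matrix.dotProduct_mulVec, Matrix.vecMul_transpose]
    simpa [PiLp.inner_apply, dotProduct, mul_comm] using h
  rw [charFun_apply, integral_map hc.aemeasurable (by fun_prop)]
  simp only [hinner]
  rw [← charFun_apply, charFun_multivariateGaussian hK, charFun_multivariateGaussian hAK]
  simp only [inner_zero_right, ← Matrix.mulVec_mulVec, Matrix.dotProduct_mulVec _ A,
    Matrix.mulVec_transpose]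

theorem tendstoInDistribution_of_map_eq {E Ω₁ Ω₂ : Type*} [TopologicalSpace E]
    [MeasurableSpace E] [OpensMeasurableSpace E] [MeasurableSpace Ω₁] [MeasurableSpace Ω₂]
    [IsProbabilityMeasure Pr] {P₁ : Measure Ω₁} [IsProbabilityMeasure P₁] {P₂ : Measure Ω₂}
    [IsProbabilityMeasure P₂] {X : ℕ → Ω → E} {Z₁ : Ω₁ → E} {Z₂ : Ω₂ → E}
    (h : TendstoInDistribution X atTop Z₁ (fun _ => Pr) P₁) (hZ : AEMeasurable Z₂ P₂)
    (hmap : P₁.map Z₁ = P₂.map Z₂) :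
    TendstoInDistribution X atTop Z₂ (fun _ => Pr) P₂ := by
  refine ⟨h.forall_aemeasurable, hZ, ?_⟩
  have e : (⟨P₁.map Z₁, Measure.isProbabilityMeasure_map h.aemeasurable_limit⟩ :
      ProbabilityMeasure E) = ⟨P₂.map Z₂, Measure.isProbabilityMeasure_map hZ⟩ := Subtype.ext hmap
  rw [← e]
  exact h.tendsto

theorem ae_tendsto_average {E : Type*} [MeasurableSpace E] {ν : Measure E} {p : ℕ → Ω → E}
    (hp : ∀ k, HasLaw (p k) ν Pr) (hindep : iIndepFun p Pr) {f : E → ℝ} (hf : Measurable f)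
    (hint : Integrable f ν) :
    ∀ᵐ ω ∂Pr, Tendsto (fun n : ℕ => (n : ℝ)⁻¹ * ∑ k ∈ Finset.range n, f (p k ω)) atTop
      (𝓝 (∫ v, f v ∂ν)) := by
  have hident : ∀ k, IdentDistrib (p k) (p 0) Pr Pr := fun k =>
    ⟨(hp k).aemeasurable, (hp 0).aemeasurable, (hp k).map_eq.trans (hp 0).map_eq.symm⟩
  have hint0 : Integrable (fun ω => f (p 0 ω)) Pr := by
    rw [← (hp 0).map_eq] at hint
    exact hint.comp_aemeasurable (hp 0).aemeasurable
  have h := strong_law_ae_real (fun k ω => f (p k ω)) hint0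
    (fun j k hjk => (hindep.indepFun hjk).comp hf hf) (fun k => (hident k).comp hf)
  have e : ∫ ω, f (p 0 ω) ∂Pr = ∫ v, f v ∂ν :=
    (hp 0).integral_comp hf.aestronglyMeasurable
  rw [e] at h
  filter_upwards [h] with ω hω
  simpa only [div_eq_inv_mul] using hω

theorem tendsto_charFun_inv_sqrt_mul_sum [IsProbabilityMeasure Pr] {X : ℕ → Ω → ℝ}
    (hX : MemLp (X 0) 2 Pr) (hmean : Pr[X 0] = 0) (hindep : iIndepFun X Pr)
    (hident : ∀ k, IdentDistrib (X k) (X 0) Pr Pr) (s : ℝ) :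
    Tendsto (fun n : ℕ => charFun (Pr.map fun ω => (√(n : ℝ))⁻¹ * ∑ k ∈ Finset.range n, X k ω) s)
      atTop (𝓝 (charFun (gaussianReal 0 Var[X 0; Pr].toNNReal) s)) := by
  have hclt := tendstoInDistribution_inv_sqrt_mul_sum_sub
    (HasLaw.id (μ := gaussianReal 0 Var[X 0; Pr].toNNReal)) hX hindep hident
  have h := ProbabilityMeasure.tendsto_iff_tendsto_charFun.1 hclt.tendsto s
  simpa [hmean] using h

theorem tendstoInDistribution_groups [IsProbabilityMeasure Pr] {κ : Type*} [Fintype κ]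
    [DecidableEq κ] {l : κ → Type*} [∀ i, Fintype (l i)] [∀ i, DecidableEq (l i)]
    {u : (i : κ) → ℕ → Ω → l i → ℝ} {Q : (i : κ) → Matrix (l i) (l i) ℝ}
    (hQ : ∀ i, (Q i).PosSemidef)
    (hindep : iIndepFun (fun (p : κ × ℕ) => u p.1 p.2) Pr)
    (hident : ∀ i k, IdentDistrib (u i k) (u i 0) Pr Pr)
    (hmem : ∀ i a, MemLp (fun ω => u i 0 ω a) 2 Pr)
    (hmean : ∀ i a, ∫ ω, u i 0 ω a ∂Pr = 0)
    (hcov : ∀ i a b, ∫ ω, u i 0 ω a * u i 0 ω b ∂Pr = Q i a b) :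
    TendstoInDistribution
      (fun (n : ℕ) (ω : Ω) => (WithLp.toLp 2 fun p : Σ i, l i =>
        (√(n : ℝ))⁻¹ * ∑ k ∈ Finset.range n, u p.1 k ω p.2 : EuclideanSpace ℝ (Σ i, l i)))
      atTop (id : EuclideanSpace ℝ (Σ i, l i) → EuclideanSpace ℝ (Σ i, l i))
      (fun _ => Pr) (multivariateGaussian 0 (blockDiagonal' Q)) := by
  have hmeas : ∀ i k, AEMeasurable (u i k) Pr := fun i k => (hident i k).aemeasurable_fst
  have hmeas' : ∀ i k a, AEMeasurable (fun ω => u i k ω a) Pr :=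
    fun i k a => aemeasurable_pi_iff.1 (hmeas i k) a
  have hY : ∀ n : ℕ, AEMeasurable (fun ω => (WithLp.toLp 2 fun p : Σ i, l i =>
      (√(n : ℝ))⁻¹ * ∑ k ∈ Finset.range n, u p.1 k ω p.2 : EuclideanSpace ℝ (Σ i, l i))) Pr := by
    intro n
    refine (WithLp.measurable_toLp 2 _).comp_aemeasurable (aemeasurable_pi_lambda _ fun p => ?_)
    exact (Finset.aemeasurable_fun_sum _ fun k _ => hmeas' _ _ _).const_mul _
  refine ⟨hY, aemeasurable_id, ProbabilityMeasure.tendsto_iff_tendsto_charFun.2 fun t => ?_⟩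
  simp only [ProbabilityMeasure.coe_mk, Measure.map_id]
  have hD := posSemidef_blockDiagonal' hQ
  -- scalar projections of the samples of one group
  let Z : κ × ℕ → Ω → ℝ := fun p ω => u p.1 p.2 ω ⬝ᵥ fun a => t ⟨p.1, a⟩
  have hg : ∀ i, Measurable fun v : l i → ℝ => v ⬝ᵥ fun a => t ⟨i, a⟩ := fun i => by
    simp only [dotProduct]
    fun_prop
  have hZindep : iIndepFun Z Pr :=
    hindep.comp (fun (p : κ × ℕ) (v : l p.1 → ℝ) => v ⬝ᵥ fun a => t ⟨p.1, a⟩) fun p => hg p.1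
  have hi : ∀ i, iIndepFun (fun k => Z (i, k)) Pr := fun i =>
    hZindep.precomp (g := fun k : ℕ => (i, k)) fun a b h => (Prod.mk.inj h).2
  have hZident : ∀ i k, IdentDistrib (Z (i, k)) (Z (i, 0)) Pr Pr := fun i k =>
    (hident i k).comp (hg i)
  have hZmeas : ∀ p, AEMeasurable (Z p) Pr := fun p => (hg p.1).comp_aemeasurable (hmeas p.1 p.2)
  have hZmem : ∀ i, MemLp (Z (i, 0)) 2 Pr := fun i => by
    simp only [Z, dotProduct]
    exact memLp_finsetSum _ fun a _ => (hmem i a).mul_const _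
  have hZmean : ∀ i, Pr[Z (i, 0)] = 0 := fun i => by
    simp only [Z, dotProduct]
    rw [integral_finsetSum _ fun a _ => ((hmem i a).integrable (by norm_num)).mul_const _]
    simp [integral_mul_const, hmean]
  have hZvar : ∀ i, Var[Z (i, 0); Pr] =
      (fun a => t ⟨i, a⟩) ⬝ᵥ (Q i *ᵥ fun a => t ⟨i, a⟩) := fun i => by
    rw [variance_of_integral_eq_zero (hZmeas _) (hZmean i)]
    have h2 : ∀ ω, Z (i, 0) ω ^ 2 =
        ∑ a, ∑ b, t ⟨i, a⟩ * t ⟨i, b⟩ * (u i 0 ω a * u i 0 ω b) := fun ω => by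
      simp only [Z, dotProduct, sq, Finset.sum_mul_sum]
      exact Finset.sum_congr rfl fun a _ => Finset.sum_congr rfl fun b _ => by ring
    have hint : ∀ a b, Integrable (fun ω => u i 0 ω a * u i 0 ω b) Pr := fun a b =>
      (hmem i a).integrable_mul (hmem i b)
    simp only [h2]
    rw [integral_finsetSum _ fun a _ => integrable_finsetSum _ fun b _ => (hint a b).const_mul _]
    simp only [dotProduct, mulVec, Finset.mul_sum]
    refine Finset.sum_congr rfl fun a _ => ?_
    rw [integral_finsetSum _ fun b _ => (hint a b).const_mul _]
    refine Finset.sum_congr rfl fun b _ => ?_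
    rw [integral_const_mul, hcov]
    ring
  -- factorization of the characteristic function
  have hfact : ∀ n : ℕ, charFun (Pr.map fun ω => (WithLp.toLp 2 fun p : Σ i, l i =>
      (√(n : ℝ))⁻¹ * ∑ k ∈ Finset.range n, u p.1 k ω p.2 : EuclideanSpace ℝ (Σ i, l i))) t =
      ∏ i, charFun (Pr.map fun ω => (√(n : ℝ))⁻¹ * ∑ k ∈ Finset.range n, Z (i, k) ω) 1 := by
    intro n
    have hinner : ∀ ω, inner ℝ (WithLp.toLp 2 fun p : Σ i, l i =>
        (√(n : ℝ))⁻¹ * ∑ k ∈ Finset.range n, u p.1 k ω p.2 : EuclideanSpace ℝ (Σ i, l i)) t =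
        (√(n : ℝ))⁻¹ * ∑ p ∈ Finset.univ ×ˢ Finset.range n, Z p ω := fun ω => by
      simp only [PiLp.inner_apply, Real.inner_apply, Fintype.sum_sigma, Finset.sum_product, Z,
        dotProduct, Finset.mul_sum, Finset.sum_mul]
      refine Finset.sum_congr rfl fun i _ => ?_
      rw [Finset.sum_comm]
      exact Finset.sum_congr rfl fun k _ => Finset.sum_congr rfl fun a _ => by ring
    rw [charFun_map_eq_charFun_inner (hY n)]
    simp only [hinner]
    rw [charFun_map_mul_comp (Finset.aemeasurable_fun_sum _ fun p _ => hZmeas p),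
      (hZindep.restrict _).charFun_map_fun_finsetSum_eq_prod fun p _ => hZmeas p,
      Finset.prod_product, Finset.prod_apply]
    refine Finset.prod_congr rfl fun i _ => ?_
    rw [charFun_map_mul_comp (Finset.aemeasurable_fun_sum _ fun p _ => hZmeas _),
      ((hi i).restrict _).charFun_map_fun_finsetSum_eq_prod fun p _ => hZmeas _]
  simp only [hfact]
  have hlim : charFun (multivariateGaussian 0 (blockDiagonal' Q)) t =
      ∏ i, charFun (gaussianReal 0 Var[Z (i, 0); Pr].toNNReal) 1 := by
    rw [charFun_multivariateGaussian hD, dotProduct_blockDiagonal'_mulVec]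
    have hcoe : ∀ i, (Var[Z (i, 0); Pr].toNNReal : ℝ) =
        (fun a => t ⟨i, a⟩) ⬝ᵥ (Q i *ᵥ fun a => t ⟨i, a⟩) := fun i => by
      rw [Real.coe_toNNReal _ (variance_nonneg _ _), hZvar]
    simp only [charFun_gaussianReal, ← Complex.exp_sum, hcoe]
    simp [Finset.sum_div]
  rw [hlim]
  refine tendsto_finsetProd _ fun i _ => ?_
  exact tendsto_charFun_inv_sqrt_mul_sum (hZmem i) (hZmean i) (hi i) (hZident i) 1

end Probability

/-! ### The regression error of one agent -/

namespace View

variable {d : ℕ} (V : View d) {S : Matrix (Fin d) (Fin d) ℝ}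

/-- The part `θ₋ᵀ z` of the signal that is invisible to the agent. -/
noncomputable def hidden (S : Matrix (Fin d) (Fin d) ℝ) (θ x : Fin d → ℝ) : ℝ :=
  (V.Pminus *ᵥ θ) ⬝ᵥ V.resid S x

/-- The score `x₊ (θ₋ᵀ z + ξ)` of a sample with features `x` and noise `ξ`. -/
noncomputable def score (S : Matrix (Fin d) (Fin d) ℝ) (θ : Fin d → ℝ) (p : (Fin d → ℝ) × ℝ)
    (a : Fin V.obs) : ℝ :=
  (V.Pplus *ᵥ p.1) a * (V.hidden S θ p.1 + p.2)

theorem hidden_eq (hS : S.PosDef) (θ x : Fin d → ℝ) :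
    V.hidden S θ x = x ⬝ᵥ θ - (V.Pplus *ᵥ x) ⬝ᵥ (V.T S *ᵥ θ) := by
  have hSs : Sᵀ = S := by simpa [IsHermitian] using hS.isHermitian
  have h1 : x ⬝ᵥ θ = (V.Pplus *ᵥ x) ⬝ᵥ (V.Pplus *ᵥ θ) + (V.Pminus *ᵥ x) ⬝ᵥ (V.Pminus *ᵥ θ) := by
    conv_lhs => rw [← Matrix.one_mulVec θ, ← V.transpose_mul_add]
    rw [Matrix.add_mulVec, dotProduct_add, ← Matrix.mulVec_mulVec, ← Matrix.mulVec_mulVec,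
      Matrix.dotProduct_mulVec, Matrix.dotProduct_mulVec x, Matrix.vecMul_transpose,
      Matrix.vecMul_transpose]
  have ht : (V.blockMinusPlus S * (V.blockPlus S)⁻¹)ᵀ = (V.blockPlus S)⁻¹ * V.blockPlusMinus S := by
    rw [Matrix.transpose_mul, transpose_nonsing_inv, V.blockPlus_transpose hS, blockMinusPlus,
      blockPlusMinus]
    simp [hSs, Matrix.mul_assoc]
  have h2 : (V.Pminus *ᵥ θ) ⬝ᵥ ((V.blockMinusPlus S * (V.blockPlus S)⁻¹) *ᵥ (V.Pplus *ᵥ x)) =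
      (V.Pplus *ᵥ x) ⬝ᵥ (((V.blockPlus S)⁻¹ * V.blockPlusMinus S) *ᵥ (V.Pminus *ᵥ θ)) := by
    rw [← ht, Matrix.dotProduct_mulVec (V.Pplus *ᵥ x), Matrix.vecMul_transpose, dotProduct_comm]
  rw [hidden, resid, dotProduct_sub, h1, h2, V.T_eq_add, Matrix.add_mulVec, dotProduct_add,
    ← Matrix.mulVec_mulVec _ _ V.Pminus, dotProduct_comm (V.Pminus *ᵥ θ)]
  ring

theorem misfit_eq (θ x : Fin d → ℝ) (a b : Fin V.obs) :
    V.misfit S θ a b x =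
      ((V.Pplus *ᵥ x) a * V.hidden S θ x) * ((V.Pplus *ᵥ x) b * V.hidden S θ x) := by
  rw [misfit, hidden]
  ring

theorem dataPlus_apply {n : ℕ} (X : Matrix (Fin n) (Fin d) ℝ) (k : Fin n) (a : Fin V.obs) :
    V.dataPlus X k a = (V.Pplus *ᵥ X k) a := by
  simp [dataPlus, Pplus, Matrix.mul_apply, mulVec, dotProduct]

end View

section Samples

variable {Ω : Type*} {d m : ℕ} {S : Matrix (Fin d) (Fin d) ℝ}

theorem gram_apply (V : View d) (x : Fin m → ℕ → Ω → (Fin d → ℝ)) (i : Fin m) (n : ℕ) (ω : Ω)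
    (a b : Fin V.obs) :
    ((V.dataPlus (dataMat x i n ω))ᵀ * V.dataPlus (dataMat x i n ω)) a b =
      ∑ k ∈ Finset.range n, (V.Pplus *ᵥ x i k ω) a * (V.Pplus *ᵥ x i k ω) b := by
  rw [Finset.sum_range]
  simp only [Matrix.mul_apply, transpose_apply, View.dataPlus_apply]
  rfl

theorem dataPlus_transpose_mulVec_labels (V : View d) (hS : S.PosDef)
    (x : Fin m → ℕ → Ω → (Fin d → ℝ)) (ξ : Fin m → ℕ → Ω → ℝ) (θ : Fin d → ℝ)
    (i : Fin m) (n : ℕ) (ω : Ω) :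
    (V.dataPlus (dataMat x i n ω))ᵀ *ᵥ labels x ξ θ i n ω =
      ((V.dataPlus (dataMat x i n ω))ᵀ * V.dataPlus (dataMat x i n ω)) *ᵥ (V.T S *ᵥ θ) +
        fun a => ∑ k ∈ Finset.range n, V.score S θ (x i k ω, ξ i k ω) a := by
  rw [← Matrix.mulVec_mulVec]
  ext a
  simp only [Pi.add_apply, Finset.sum_range]
  change ∑ k, V.dataPlus (dataMat x i n ω) k a * labels x ξ θ i n ω k =
    ∑ k, V.dataPlus (dataMat x i n ω) k a * (V.dataPlus (dataMat x i n ω) *ᵥ (V.T S *ᵥ θ)) k + _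
  rw [← Finset.sum_add_distrib]
  refine Finset.sum_congr rfl fun k _ => ?_
  have h : labels x ξ θ i n ω k = (V.Pplus *ᵥ x i k ω) ⬝ᵥ (V.T S *ᵥ θ) +
      (V.hidden S θ (x i k ω) + ξ i k ω) := by
    rw [V.hidden_eq hS]
    simp only [labels, Pi.add_apply, mulVec, dataMat, Matrix.of_apply]
    ring
  have hk : V.dataPlus (dataMat x i n ω) k = V.Pplus *ᵥ x i k ω :=
    funext fun b => V.dataPlus_apply _ k b
  have hm : (V.dataPlus (dataMat x i n ω) *ᵥ (V.T S *ᵥ θ)) k =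
      (V.Pplus *ᵥ x i k ω) ⬝ᵥ (V.T S *ᵥ θ) := congrArg (· ⬝ᵥ (V.T S *ᵥ θ)) hk
  rw [h, hm, hk, mul_add]
  rfl

theorem scaled_aggSol_sub {V : Fin m → View d} (hS : S.PosDef)
    {W : Fin m → Matrix (Fin d) (Fin d) ℝ} (hW : Admissible V S W)
    (x : Fin m → ℕ → Ω → (Fin d → ℝ)) (ξ : Fin m → ℕ → Ω → ℝ) (θ : Fin d → ℝ)
    {n : ℕ} {ω : Ω} (hn : n ≠ 0)
    (h : ∀ i, IsUnit (((V i).dataPlus (dataMat x i n ω))ᵀ *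
      (V i).dataPlus (dataMat x i n ω)).det) (c : ℝ) :
    c • (aggEst V S W x ξ θ n ω - θ) = ∑ i, aggGain V S W i *ᵥ
      (pinv ((n : ℝ)⁻¹ • (((V i).dataPlus (dataMat x i n ω))ᵀ *
        (V i).dataPlus (dataMat x i n ω))) *ᵥ
      fun a => c * (n : ℝ)⁻¹ * ∑ k ∈ Finset.range n, (V i).score S θ (x i k ω, ξ i k ω) a) := by
  have hn' : (n : ℝ) ≠ 0 := Nat.cast_ne_zero.2 hn
  rw [aggEst, hW.argmin_impLoss]
  have h1 : (fun i => impEst V S x ξ θ i n ω) = fun i => (V i).Tlift S *ᵥ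
      ((((V i).dataPlus (dataMat x i n ω))ᵀ * (V i).dataPlus (dataMat x i n ω))⁻¹ *ᵥ
        (((V i).dataPlus (dataMat x i n ω))ᵀ *ᵥ labels x ξ θ i n ω)) :=
    funext fun i => (V i).imp_eq_Tlift_mulVec _ _ (h i)
  rw [h1, hW.aggSol_sub, Finset.smul_sum]
  refine Finset.sum_congr rfl fun i _ => ?_
  rw [dataPlus_transpose_mulVec_labels (V i) hS, Matrix.mulVec_add, Matrix.mulVec_mulVec,
    nonsing_inv_mul _ (h i), Matrix.one_mulVec, add_sub_cancel_left]
  set G := ((V i).dataPlus (dataMat x i n ω))ᵀ * (V i).dataPlus (dataMat x i n ω) with hG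
  have hp : pinv ((n : ℝ)⁻¹ • G) = (n : ℝ) • G⁻¹ := by
    have hu : IsUnit G.det := h i
    rw [pinv_eq_inv]
    · exact inv_eq_right_inv (by simp [mul_nonsing_inv _ hu, smul_smul, hn'])
    · rw [det_smul]
      exact (IsUnit.pow _ (isUnit_iff_ne_zero.2 (inv_ne_zero hn'))).mul hu
  have hv : (fun a => c * (n : ℝ)⁻¹ *
      ∑ k ∈ Finset.range n, (V i).score S θ (x i k ω, ξ i k ω) a) =
      (c * (n : ℝ)⁻¹) • fun a => ∑ k ∈ Finset.range n, (V i).score S θ (x i k ω, ξ i k ω) a := rfl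
  rw [hp, hv, Matrix.mulVec_smul, Matrix.smul_mulVec, smul_smul, mul_assoc, inv_mul_cancel₀ hn',
    mul_one, Matrix.mulVec_smul]

end Samples

/-! ### Moments of the scores -/

section Moments

variable {d : ℕ} (V : View d) {μ : Measure (Fin d → ℝ)}
  {S : Matrix (Fin d) (Fin d) ℝ} {θ : Fin d → ℝ} {σ : ℝ}

theorem memLp_Pplus (hmem : ∀ j, MemLp (fun v : Fin d → ℝ => v j) 2 μ) (a : Fin V.obs) :
    MemLp (fun x => (V.Pplus *ᵥ x) a) 2 μ := by
  simpa only [View.Pplus_mulVec] using hmem _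

theorem integral_Pplus_mul_Pplus (hcov : ∀ j k, ∫ v, v j * v k ∂μ = S j k) (a b : Fin V.obs) :
    ∫ x, (V.Pplus *ᵥ x) a * (V.Pplus *ᵥ x) b ∂μ = V.blockPlus S a b := by
  simp only [View.Pplus_mulVec, hcov]
  simp [View.blockPlus, View.Pplus, Matrix.mul_apply]

theorem continuous_hidden : Continuous (V.hidden S θ) := by
  unfold View.hidden View.resid
  fun_prop

theorem memLp_Pplus_mul_hidden (hmisfit : ∀ a b, Integrable (V.misfit S θ a b) μ)
    (a : Fin V.obs) : MemLp (fun x => (V.Pplus *ᵥ x) a * V.hidden S θ x) 2 μ := by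
  have hc : Continuous fun x => (V.Pplus *ᵥ x) a * V.hidden S θ x :=
    (by fun_prop : Continuous fun x => (V.Pplus *ᵥ x) a).mul (continuous_hidden V)
  rw [memLp_two_iff_integrable_sq hc.aestronglyMeasurable]
  refine (hmisfit a a).congr (.of_forall fun x => ?_)
  simp only [V.misfit_eq, sq]

theorem integral_Pplus_mul_hidden (hS : S.PosDef)
    (hmem : ∀ j, MemLp (fun v : Fin d → ℝ => v j) 2 μ)
    (hcov : ∀ j k, ∫ v, v j * v k ∂μ = S j k) (a : Fin V.obs) :
    ∫ x, (V.Pplus *ᵥ x) a * V.hidden S θ x ∂μ = 0 := by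
  have e : ∀ x, (V.Pplus *ᵥ x) a * V.hidden S θ x =
      (∑ j, θ j * (x (V.perm (Sum.inl a)) * x j)) -
        ∑ b, (V.T S *ᵥ θ) b * ((V.Pplus *ᵥ x) a * (V.Pplus *ᵥ x) b) := fun x => by
    rw [V.hidden_eq hS, mul_sub]
    simp only [dotProduct, Finset.mul_sum, View.Pplus_mulVec]
    congr 1 <;> exact Finset.sum_congr rfl fun j _ => by ring
  have i1 : ∀ j, Integrable (fun x : Fin d → ℝ => θ j * (x (V.perm (Sum.inl a)) * x j)) μ :=
    fun j => ((hmem _).integrable_mul (hmem j)).const_mul _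
  have i2 : ∀ b, Integrable (fun x : Fin d → ℝ =>
      (V.T S *ᵥ θ) b * ((V.Pplus *ᵥ x) a * (V.Pplus *ᵥ x) b)) μ :=
    fun b => ((memLp_Pplus V hmem a).integrable_mul (memLp_Pplus V hmem b)).const_mul _
  simp only [e]
  rw [integral_sub (integrable_finsetSum _ fun j _ => i1 j) (integrable_finsetSum _ fun b _ => i2 b),
    integral_finsetSum _ fun j _ => i1 j, integral_finsetSum _ fun b _ => i2 b]
  simp only [integral_const_mul, hcov, integral_Pplus_mul_Pplus V hcov]
  have h : (V.blockPlus S *ᵥ (V.T S *ᵥ θ)) a = (V.Pplus *ᵥ (S *ᵥ θ)) a := by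
    rw [V.T_eq hS, Matrix.mulVec_mulVec, ← Matrix.mul_assoc, ← Matrix.mul_assoc,
      mul_nonsing_inv _ (V.isUnit_det_blockPlus hS), Matrix.one_mul, Matrix.mulVec_mulVec]
  rw [View.Pplus_mulVec, mulVec, mulVec] at h
  rw [sub_eq_zero, ← dotProduct, ← dotProduct, dotProduct_comm, dotProduct_comm (V.T S *ᵥ θ)]
  exact h.symm

/-- The covariance matrix `E[x₊ θ₋ᵀ z zᵀ θ₋ x₊ᵀ] + σ² Σ₊` of the scores. -/
noncomputable def scoreCov (μ : Measure (Fin d → ℝ)) (S : Matrix (Fin d) (Fin d) ℝ)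
    (θ : Fin d → ℝ) (σ : ℝ) : Matrix (Fin V.obs) (Fin V.obs) ℝ :=
  (Matrix.of fun a b => ∫ x, V.misfit S θ a b x ∂μ) + σ ^ 2 • V.blockPlus S

theorem posDef_scoreCov (hS : S.PosDef) (hmisfit : ∀ a b, Integrable (V.misfit S θ a b) μ)
    (hσ : 0 < σ) : (scoreCov V μ S θ σ).PosDef := by
  refine PosDef.posSemidef_add ?_ ((V.posDef_blockPlus hS).smul (pow_pos hσ 2))
  refine .of_dotProduct_mulVec_nonneg ?_ fun v => ?_
  · ext a b
    simp [V.misfit_eq, mul_comm]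
  · have e : star v ⬝ᵥ ((Matrix.of fun a b => ∫ x, V.misfit S θ a b x ∂μ) *ᵥ v) =
        ∫ x, (∑ a, v a * ((V.Pplus *ᵥ x) a * V.hidden S θ x)) ^ 2 ∂μ := by
      have e2 : ∀ x, (∑ a, v a * ((V.Pplus *ᵥ x) a * V.hidden S θ x)) ^ 2 =
          ∑ a, ∑ b, v a * v b * V.misfit S θ a b x := fun x => by
        rw [sq, Finset.sum_mul_sum]
        exact Finset.sum_congr rfl fun a _ => Finset.sum_congr rfl fun b _ => by
          rw [V.misfit_eq]; ring
      simp only [e2]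
      rw [integral_finsetSum _ fun a _ => integrable_finsetSum _ fun b _ =>
        (hmisfit a b).const_mul _]
      simp only [dotProduct, mulVec, star_trivial, Finset.mul_sum, Matrix.of_apply]
      refine Finset.sum_congr rfl fun a _ => ?_
      rw [integral_finsetSum _ fun b _ => (hmisfit a b).const_mul _]
      exact Finset.sum_congr rfl fun b _ => by rw [integral_const_mul]; ring
    rw [e]
    exact integral_nonneg fun x => sq_nonneg _

theorem posDef_Wstar (hS : S.PosDef) (hmisfit : ∀ a b, Integrable (V.misfit S θ a b) μ)
    (hσ : 0 < σ) : (V.Wstar μ S θ σ).PosDef := by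
  have h := (posDef_scoreCov V hS hmisfit hσ).inv.conjTranspose_mul_mul_same (B := V.blockPlus S)
    (mulVec_injective_iff_isUnit.2 (V.posDef_blockPlus hS).isUnit)
  rwa [(V.posDef_blockPlus hS).isHermitian.eq] at h

theorem inv_Wstar (hS : S.PosDef) (hmisfit : ∀ a b, Integrable (V.misfit S θ a b) μ)
    (hσ : 0 < σ) : (V.Wstar μ S θ σ)⁻¹ =
      (V.blockPlus S)⁻¹ * scoreCov V μ S θ σ * (V.blockPlus S)⁻¹ := by
  have hu := (isUnit_iff_isUnit_det _).1 (posDef_scoreCov V hS hmisfit hσ).isUnit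
  change (V.blockPlus S * (scoreCov V μ S θ σ)⁻¹ * V.blockPlus S)⁻¹ = _
  rw [Matrix.mul_inv_rev, Matrix.mul_inv_rev, nonsing_inv_nonsing_inv _ hu, Matrix.mul_assoc]

theorem measurable_score : Measurable (V.score S θ) := by
  refine measurable_pi_lambda _ fun a => Continuous.measurable ?_
  have h := continuous_hidden (S := S) (θ := θ) V
  unfold View.score
  fun_prop

variable {γ : Measure ℝ} [IsProbabilityMeasure γ]

theorem memLp_score (hmem : ∀ j, MemLp (fun v : Fin d → ℝ => v j) 2 μ)
    (hmisfit : ∀ a b, Integrable (V.misfit S θ a b) μ) (hγ : MemLp id 2 γ) (a : Fin V.obs) :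
    MemLp (fun p => V.score S θ p a) 2 (μ.prod γ) := by
  have h1 : MemLp (fun p : (Fin d → ℝ) × ℝ => (V.Pplus *ᵥ p.1) a * V.hidden S θ p.1) 2
      (μ.prod γ) := (memLp_Pplus_mul_hidden V hmisfit a).comp_measurePreserving measurePreserving_fst
  have h2 : MemLp (fun p : (Fin d → ℝ) × ℝ => (V.Pplus *ᵥ p.1) a * p.2) 2 (μ.prod γ) := by
    have hc : Continuous fun p : (Fin d → ℝ) × ℝ => (V.Pplus *ᵥ p.1) a * p.2 := by fun_prop
    rw [memLp_two_iff_integrable_sq hc.aestronglyMeasurable]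
    simp only [mul_pow]
    exact (memLp_Pplus V hmem a).integrable_sq.mul_prod hγ.integrable_sq
  exact (h1.add h2).ae_eq (.of_forall fun p => by simp only [View.score, mul_add, Pi.add_apply])

variable [IsProbabilityMeasure μ]

theorem integral_score (hS : S.PosDef) (hmem : ∀ j, MemLp (fun v : Fin d → ℝ => v j) 2 μ)
    (hcov : ∀ j k, ∫ v, v j * v k ∂μ = S j k)
    (hmisfit : ∀ a b, Integrable (V.misfit S θ a b) μ) (hγ : MemLp id 2 γ)
    (hγ0 : ∫ t, t ∂γ = 0) (a : Fin V.obs) :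
    ∫ p, V.score S θ p a ∂(μ.prod γ) = 0 := by
  have i1 : Integrable (fun p : (Fin d → ℝ) × ℝ =>
      ((V.Pplus *ᵥ p.1) a * V.hidden S θ p.1) * 1) (μ.prod γ) :=
    ((memLp_Pplus_mul_hidden V hmisfit a).integrable (by norm_num)).mul_prod
      (integrable_const (1 : ℝ))
  have i2 : Integrable (fun p : (Fin d → ℝ) × ℝ => (V.Pplus *ᵥ p.1) a * p.2) (μ.prod γ) :=
    ((memLp_Pplus V hmem a).integrable (by norm_num)).mul_prod (hγ.integrable (by norm_num))
  have e : ∀ p, V.score S θ p a =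
      ((V.Pplus *ᵥ p.1) a * V.hidden S θ p.1) * 1 + (V.Pplus *ᵥ p.1) a * p.2 := fun p => by
    rw [View.score]; ring
  simp only [e]
  rw [integral_add i1 i2, integral_prod_mul (fun x => (V.Pplus *ᵥ x) a * V.hidden S θ x)
    (fun _ : ℝ => (1 : ℝ)), integral_prod_mul (fun x => (V.Pplus *ᵥ x) a) (fun t : ℝ => t),
    integral_Pplus_mul_hidden V hS hmem hcov, hγ0]
  simp

theorem integral_score_mul_score
    (hmem : ∀ j, MemLp (fun v : Fin d → ℝ => v j) 2 μ)
    (hcov : ∀ j k, ∫ v, v j * v k ∂μ = S j k)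
    (hmisfit : ∀ a b, Integrable (V.misfit S θ a b) μ) (hγ : MemLp id 2 γ)
    (hγ0 : ∫ t, t ∂γ = 0) (hγ2 : ∫ t, t ^ 2 ∂γ = σ ^ 2) (a b : Fin V.obs) :
    ∫ p, V.score S θ p a * V.score S θ p b ∂(μ.prod γ) = scoreCov V μ S θ σ a b := by
  let F : Fin V.obs → (Fin d → ℝ) → ℝ := fun a x => (V.Pplus *ᵥ x) a * V.hidden S θ x
  let g : Fin V.obs → (Fin d → ℝ) → ℝ := fun a x => (V.Pplus *ᵥ x) a
  have hF : ∀ a, MemLp (F a) 2 μ := memLp_Pplus_mul_hidden V hmisfit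
  have hg : ∀ a, MemLp (g a) 2 μ := memLp_Pplus V hmem
  have i1 : Integrable (fun p : (Fin d → ℝ) × ℝ => (F a * F b) p.1 * 1) (μ.prod γ) :=
    ((hF a).integrable_mul (hF b)).mul_prod (integrable_const (1 : ℝ))
  have i2 : Integrable (fun p : (Fin d → ℝ) × ℝ => (F a * g b + g a * F b) p.1 * p.2) (μ.prod γ) :=
    (((hF a).integrable_mul (hg b)).add ((hg a).integrable_mul (hF b))).mul_prod
      (hγ.integrable (by norm_num))
  have i3 : Integrable (fun p : (Fin d → ℝ) × ℝ => (g a * g b) p.1 * p.2 ^ 2) (μ.prod γ) :=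
    ((hg a).integrable_mul (hg b)).mul_prod hγ.integrable_sq
  have i12 : Integrable (fun p : (Fin d → ℝ) × ℝ =>
      (F a * F b) p.1 * 1 + (F a * g b + g a * F b) p.1 * p.2) (μ.prod γ) := i1.add i2
  have e : ∀ p, V.score S θ p a * V.score S θ p b = (F a * F b) p.1 * 1 +
      (F a * g b + g a * F b) p.1 * p.2 + (g a * g b) p.1 * p.2 ^ 2 := fun p => by
    simp only [View.score, Pi.mul_apply, Pi.add_apply, F, g]; ring
  simp only [e]
  rw [integral_add i12 i3, integral_add i1 i2,
    integral_prod_mul (F a * F b) (fun _ : ℝ => (1 : ℝ)),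
    integral_prod_mul (F a * g b + g a * F b) (fun t : ℝ => t),
    integral_prod_mul (g a * g b) (fun t : ℝ => t ^ 2), hγ0, hγ2]
  have h2 : ∫ x, (g a * g b) x ∂μ = V.blockPlus S a b := integral_Pplus_mul_Pplus V hcov a b
  rw [h2]
  simp [scoreCov, V.misfit_eq, F, mul_comm]

end Moments

/-! ### Asymptotics of the aggregate -/

section Asymptotics

variable {Ω : Type*} [MeasurableSpace Ω] {Pr : Measure Ω} {d m : ℕ} {V : Fin m → View d}
  {μ : Measure (Fin d → ℝ)} {S : Matrix (Fin d) (Fin d) ℝ} {θ : Fin d → ℝ}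
  {x : Fin m → ℕ → Ω → (Fin d → ℝ)} {ξ : Fin m → ℕ → Ω → ℝ}

theorem ae_tendsto_gram (V : View d) (hmem : ∀ j, MemLp (fun v : Fin d → ℝ => v j) 2 μ)
    (hcov : ∀ j k, ∫ v, v j * v k ∂μ = S j k) {i : Fin m}
    (hx : ∀ k, HasLaw (x i k) μ Pr) (hindep : iIndepFun (x i) Pr) :
    ∀ᵐ ω ∂Pr, Tendsto (fun n : ℕ => (n : ℝ)⁻¹ •
      ((V.dataPlus (dataMat x i n ω))ᵀ * V.dataPlus (dataMat x i n ω))) atTop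
      (𝓝 (V.blockPlus S)) := by
  have h : ∀ a b, ∀ᵐ ω ∂Pr, Tendsto (fun n : ℕ => (n : ℝ)⁻¹ *
      ∑ k ∈ Finset.range n, (V.Pplus *ᵥ x i k ω) a * (V.Pplus *ᵥ x i k ω) b) atTop
      (𝓝 (V.blockPlus S a b)) := fun a b => by
    rw [← integral_Pplus_mul_Pplus V hcov]
    have hc : Continuous fun v : Fin d → ℝ => (V.Pplus *ᵥ v) a * (V.Pplus *ᵥ v) b := by fun_prop
    exact ae_tendsto_average hx hindep hc.measurable
      ((memLp_Pplus V hmem a).integrable_mul (memLp_Pplus V hmem b))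
  filter_upwards [ae_all_iff.2 fun a => ae_all_iff.2 (h a)] with ω hω
  refine tendsto_pi_nhds.2 fun a => tendsto_pi_nhds.2 fun b => ?_
  simpa only [Matrix.smul_apply, gram_apply, smul_eq_mul] using hω a b

/-- Once the empirical covariance is invertible, so is the Gram matrix. -/
theorem isUnit_det_gram_of_smul {n : ℕ} {l : Type*} [Fintype l] [DecidableEq l]
    {G : Matrix l l ℝ} (h : IsUnit ((n : ℝ)⁻¹ • G).det) : IsUnit G.det := by
  rw [det_smul] at h
  exact isUnit_of_mul_isUnit_right h

theorem ae_eventually_isUnit_gram (V : View d) (hS : S.PosDef)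
    (hmem : ∀ j, MemLp (fun v : Fin d → ℝ => v j) 2 μ)
    (hcov : ∀ j k, ∫ v, v j * v k ∂μ = S j k) {i : Fin m}
    (hx : ∀ k, HasLaw (x i k) μ Pr) (hindep : iIndepFun (x i) Pr) :
    ∀ᵐ ω ∂Pr, ∀ᶠ n in atTop,
      IsUnit ((V.dataPlus (dataMat x i n ω))ᵀ * V.dataPlus (dataMat x i n ω)).det := by
  filter_upwards [ae_tendsto_gram V hmem hcov hx hindep] with ω hω
  exact (tendsto_pinv_of_isUnit (V.isUnit_det_blockPlus hS) hω).1.mono fun n h =>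
    isUnit_det_gram_of_smul h

theorem aemeasurable_aggEst (hx : ∀ i k, AEMeasurable (x i k) Pr)
    (hξ : ∀ i k, AEMeasurable (ξ i k) Pr) {W : Fin m → Matrix (Fin d) (Fin d) ℝ}
    (hW : Admissible V S W) (n : ℕ) : AEMeasurable (aggEst V S W x ξ θ n) Pr := by
  have hdata : ∀ (i : Fin m) (k : Fin n) (j : Fin d),
      AEMeasurable (fun ω => dataMat x i n ω k j) Pr :=
    fun i k j => aemeasurable_pi_iff.1 (hx i k) j
  have hconst : ∀ {k l : Type} (A : Matrix k l ℝ) (a : k) (b : l),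
      AEMeasurable (fun _ : Ω => A a b) Pr := fun A a b => aemeasurable_const
  have hplus : ∀ (i : Fin m) (k : Fin n) (a : Fin (V i).obs),
      AEMeasurable (fun ω => (V i).dataPlus (dataMat x i n ω) k a) Pr := fun i =>
    aemeasurable_matrix_mul (hdata i) (hconst _)
  have hTplus : ∀ (i : Fin m) (a : Fin d) (k : Fin n),
      AEMeasurable (fun ω => (((V i).T S)ᵀ * ((V i).dataPlus (dataMat x i n ω))ᵀ) a k) Pr :=
    fun i => aemeasurable_matrix_mul (hconst _) fun a k => hplus i k a
  have hy : ∀ (i : Fin m) (k : Fin n), AEMeasurable (fun ω => labels x ξ θ i n ω k) Pr :=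
    fun i k => (aemeasurable_mulVec (v := fun _ => θ) (hdata i)
      (fun _ => aemeasurable_const) k).add (hξ i k)
  have himp : ∀ (i : Fin m) (j : Fin d), AEMeasurable (fun ω => impEst V S x ξ θ i n ω j) Pr :=
    fun i => aemeasurable_mulVec (aemeasurable_pinv (aemeasurable_matrix_mul
      (aemeasurable_matrix_mul (hTplus i) (hplus i)) (hconst _)))
      (aemeasurable_mulVec (hTplus i) (hy i))
  refine aemeasurable_pi_lambda _ fun j => ?_
  simp only [aggEst, hW.argmin_impLoss, aggSol]
  refine aemeasurable_mulVec (hconst _) (fun j => ?_) j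
  simp only [Finset.sum_apply]
  exact Finset.aemeasurable_fun_sum _ fun i _ => aemeasurable_mulVec (hconst _) (himp i) j

/-- The aggregated error, for the local inverse covariances `B` and the local errors `z`. -/
noncomputable def aggErr (V : Fin m → View d) (S : Matrix (Fin d) (Fin d) ℝ)
    (W : Fin m → Matrix (Fin d) (Fin d) ℝ)
    (q : EuclideanSpace ℝ (Σ i, Fin (V i).obs) × ((i : Fin m) → Fin (V i).obs → Fin (V i).obs → ℝ)) :
    EuclideanSpace ℝ (Fin d) :=
  WithLp.toLp 2 (∑ i, aggGain V S W i *ᵥ (Matrix.of (q.2 i) *ᵥ fun a => q.1 ⟨i, a⟩))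

theorem continuous_aggErr (W : Fin m → Matrix (Fin d) (Fin d) ℝ) :
    Continuous (aggErr V S W) := by
  refine (PiLp.continuous_toLp 2 _).comp (continuous_finsetSum _ fun i _ => ?_)
  have h1 : Continuous fun q : EuclideanSpace ℝ (Σ i, Fin (V i).obs) ×
      ((i : Fin m) → Fin (V i).obs → Fin (V i).obs → ℝ) =>
      (Matrix.of (q.2 i) : Matrix (Fin (V i).obs) (Fin (V i).obs) ℝ) :=
    (continuous_apply i).comp continuous_snd
  have h2 : Continuous fun q : EuclideanSpace ℝ (Σ i, Fin (V i).obs) ×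
      ((i : Fin m) → Fin (V i).obs → Fin (V i).obs → ℝ) => fun a => q.1 ⟨i, a⟩ := by
    fun_prop
  exact continuous_const.matrix_mulVec (h1.matrix_mulVec h2)

theorem map_aggErr_multivariateGaussian (W : Fin m → Matrix (Fin d) (Fin d) ℝ)
    {Q B : (i : Fin m) → Matrix (Fin (V i).obs) (Fin (V i).obs) ℝ}
    (hQ : ∀ i, (Q i).PosSemidef) :
    (multivariateGaussian 0 (blockDiagonal' Q)).map
        (fun z => aggErr V S W (z, fun i a b => B i a b)) =
      multivariateGaussian 0 (∑ i, (aggGain V S W i * B i) * Q i * (aggGain V S W i * B i)ᵀ) := by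
  let A : Matrix (Fin d) (Σ i, Fin (V i).obs) ℝ :=
    Matrix.of fun j p => (aggGain V S W p.1 * B p.1) j p.2
  have h1 : (fun z => aggErr V S W (z, fun i a b => B i a b)) = fun z =>
      (WithLp.toLp 2 (A *ᵥ WithLp.ofLp z) : EuclideanSpace ℝ (Fin d)) := by
    funext z
    refine congrArg (WithLp.toLp 2) (funext fun j => ?_)
    have hB : ∀ i, Matrix.of (fun a b => B i a b) = B i := fun i => rfl
    simp only [hB, Matrix.mulVec_mulVec, Finset.sum_apply]
    simp only [mulVec, dotProduct, Fintype.sum_sigma, A, Matrix.of_apply]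
  have h2 : A * blockDiagonal' Q * Aᵀ =
      ∑ i, (aggGain V S W i * B i) * Q i * (aggGain V S W i * B i)ᵀ := by
    ext j k
    have h3 : (A * blockDiagonal' Q * Aᵀ) j k = A j ⬝ᵥ (blockDiagonal' Q *ᵥ A k) := by
      rw [Matrix.mul_assoc]; rfl
    rw [h3, dotProduct_blockDiagonal'_mulVec, Matrix.sum_apply]
    refine Finset.sum_congr rfl fun i _ => ?_
    rw [Matrix.mul_assoc (_ * _)]
    rfl
  rw [h1, map_mulVec_multivariateGaussian (posSemidef_blockDiagonal' hQ), h2]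

theorem ae_tendsto_pinv_gram (hS : S.PosDef) (hmem : ∀ j, MemLp (fun v : Fin d → ℝ => v j) 2 μ)
    (hcov : ∀ j k, ∫ v, v j * v k ∂μ = S j k) (hx : ∀ i k, HasLaw (x i k) μ Pr)
    (hindep : ∀ i, iIndepFun (x i) Pr) :
    ∀ᵐ ω ∂Pr, ∀ i, Tendsto (fun n : ℕ => pinv ((n : ℝ)⁻¹ •
      (((V i).dataPlus (dataMat x i n ω))ᵀ * (V i).dataPlus (dataMat x i n ω)))) atTop
      (𝓝 ((V i).blockPlus S)⁻¹) := by
  refine ae_all_iff.2 fun i => ?_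
  filter_upwards [ae_tendsto_gram (V i) hmem hcov (hx i) (hindep i)] with ω hω
  exact (tendsto_pinv_of_isUnit ((V i).isUnit_det_blockPlus hS) hω).2

/-- The expansion of the scaled aggregated error, valid almost surely for all large `n`. -/
theorem ae_eventually_scaled_aggEst_sub (hS : S.PosDef)
    (hmem : ∀ j, MemLp (fun v : Fin d → ℝ => v j) 2 μ)
    (hcov : ∀ j k, ∫ v, v j * v k ∂μ = S j k) (hx : ∀ i k, HasLaw (x i k) μ Pr)
    (hindep : ∀ i, iIndepFun (x i) Pr) {W : Fin m → Matrix (Fin d) (Fin d) ℝ} (hW : Admissible V S W) :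
    ∀ᵐ ω ∂Pr, ∀ᶠ n : ℕ in atTop, ∀ c : ℝ,
      WithLp.toLp 2 (c • (aggEst V S W x ξ θ n ω - θ)) = aggErr V S W
        (WithLp.toLp 2 fun p => c * (n : ℝ)⁻¹ *
          ∑ k ∈ Finset.range n, (V p.1).score S θ (x p.1 k ω, ξ p.1 k ω) p.2,
        fun i a b => pinv ((n : ℝ)⁻¹ • (((V i).dataPlus (dataMat x i n ω))ᵀ *
          (V i).dataPlus (dataMat x i n ω))) a b) := by
  filter_upwards [ae_all_iff.2 fun i =>
    ae_eventually_isUnit_gram (V i) hS hmem hcov (hx i) (hindep i)] with ω hω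
  filter_upwards [eventually_all.2 hω, eventually_ne_atTop 0] with n hn hn0 c
  rw [scaled_aggSol_sub hS hW x ξ θ hn0 hn c]
  rfl

variable {γ : Measure ℝ} [IsProbabilityMeasure γ] [IsProbabilityMeasure μ]
  [IsProbabilityMeasure Pr] {W : Fin m → Matrix (Fin d) (Fin d) ℝ} {σ : ℝ}

theorem tendstoInMeasure_aggEst (hS : S.PosDef)
    (hmem : ∀ j, MemLp (fun v : Fin d → ℝ => v j) 2 μ)
    (hcov : ∀ j k, ∫ v, v j * v k ∂μ = S j k)
    (hmisfit : ∀ i a b, Integrable ((V i).misfit S θ a b) μ)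
    (hγ : MemLp id 2 γ) (hγ0 : ∫ t, t ∂γ = 0) (hx : ∀ i k, HasLaw (x i k) μ Pr)
    (hξ : ∀ i k, AEMeasurable (ξ i k) Pr)
    (hpair : ∀ i k, HasLaw (fun ω => (x i k ω, ξ i k ω)) (μ.prod γ) Pr)
    (hindep : iIndepFun (fun (p : Fin m × ℕ) (ω : Ω) => (x p.1 p.2 ω, ξ p.1 p.2 ω)) Pr)
    (hW : Admissible V S W) :
    TendstoInMeasure Pr (fun n ω => aggEst V S W x ξ θ n ω) atTop (fun _ => θ) := by
  have hpair_indep : ∀ i, iIndepFun (fun k ω => (x i k ω, ξ i k ω)) Pr := fun i =>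
    hindep.precomp (g := fun k : ℕ => (i, k)) fun a b h => (Prod.mk.inj h).2
  have hx_indep : ∀ i, iIndepFun (x i) Pr := fun i =>
    (hpair_indep i).comp (fun _ p => p.1) fun _ => measurable_fst
  refine tendstoInMeasure_of_tendsto_ae
    (fun n => (aemeasurable_aggEst (fun i k => (hx i k).aemeasurable) hξ hW n).aestronglyMeasurable)
    ?_
  have hscore : ∀ᵐ ω ∂Pr, ∀ i a, Tendsto (fun n : ℕ => (n : ℝ)⁻¹ *
      ∑ k ∈ Finset.range n, (V i).score S θ (x i k ω, ξ i k ω) a) atTop (𝓝 0) := by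
    refine ae_all_iff.2 fun i => ae_all_iff.2 fun a => ?_
    have h := ae_tendsto_average (hpair i) (hpair_indep i)
      (f := fun p => (V i).score S θ p a)
      ((measurable_pi_apply a).comp (measurable_score (V i)))
      ((memLp_score (V i) hmem (hmisfit i) hγ a).integrable (by norm_num))
    rwa [integral_score (V i) hS hmem hcov (hmisfit i) hγ hγ0] at h
  filter_upwards [hscore, ae_tendsto_pinv_gram (V := V) hS hmem hcov hx hx_indep,
    ae_eventually_scaled_aggEst_sub (V := V) (ξ := ξ) (θ := θ) hS hmem hcov hx hx_indep hW]
    with ω h1 h2 h3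
  have hz : Tendsto (fun n : ℕ => (WithLp.toLp 2 fun p => 1 * (n : ℝ)⁻¹ *
      ∑ k ∈ Finset.range n, (V p.1).score S θ (x p.1 k ω, ξ p.1 k ω) p.2 :
      EuclideanSpace ℝ (Σ i, Fin (V i).obs))) atTop (𝓝 0) := by
    refine ((PiLp.continuous_toLp 2 _).tendsto 0).comp (tendsto_pi_nhds.2 fun p => ?_)
    simp only [one_mul]
    exact h1 p.1 p.2
  have hB : Tendsto (fun (n : ℕ) (i : Fin m) (a b : Fin (V i).obs) =>
      pinv ((n : ℝ)⁻¹ • (((V i).dataPlus (dataMat x i n ω))ᵀ *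
        (V i).dataPlus (dataMat x i n ω))) a b) atTop
      (𝓝 fun i a b => ((V i).blockPlus S)⁻¹ a b) :=
    tendsto_pi_nhds.2 h2
  have hlim := ((continuous_aggErr (V := V) (S := S) W).tendsto _).comp (hz.prodMk_nhds hB)
  have h0 : aggErr V S W (0, fun i a b => ((V i).blockPlus S)⁻¹ a b) = 0 := by
    have : ∀ i : Fin m, (fun a : Fin (V i).obs =>
        (0 : EuclideanSpace ℝ (Σ i, Fin (V i).obs)) ⟨i, a⟩) = 0 := fun i => rfl
    simp only [aggErr, this, Matrix.mulVec_zero, Finset.sum_const_zero]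
    rfl
  rw [h0] at hlim
  have hlim' := ((PiLp.continuous_ofLp 2 _).tendsto _).comp hlim
  have h4 : Tendsto (fun n => aggEst V S W x ξ θ n ω - θ) atTop (𝓝 0) := by
    refine hlim'.congr' ?_
    filter_upwards [h3] with n hn
    have := congrArg WithLp.ofLp (hn 1)
    rw [one_smul] at this
    exact this.symm
  simpa using h4.add_const θ

theorem tendstoInDistribution_aggEst (hS : S.PosDef)
    (hmem : ∀ j, MemLp (fun v : Fin d → ℝ => v j) 2 μ)
    (hcov : ∀ j k, ∫ v, v j * v k ∂μ = S j k)
    (hmisfit : ∀ i a b, Integrable ((V i).misfit S θ a b) μ) (hσ : 0 < σ)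
    (hγ : MemLp id 2 γ) (hγ0 : ∫ t, t ∂γ = 0) (hγ2 : ∫ t, t ^ 2 ∂γ = σ ^ 2)
    (hx : ∀ i k, HasLaw (x i k) μ Pr) (hξ : ∀ i k, AEMeasurable (ξ i k) Pr)
    (hpair : ∀ i k, HasLaw (fun ω => (x i k ω, ξ i k ω)) (μ.prod γ) Pr)
    (hindep : iIndepFun (fun (p : Fin m × ℕ) (ω : Ω) => (x p.1 p.2 ω, ξ p.1 p.2 ω)) Pr)
    (hW : Admissible V S W) :
    TendstoInDistribution
      (fun (n : ℕ) (ω : Ω) =>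
        (WithLp.toLp 2 (√(n : ℝ) • (aggEst V S W x ξ θ n ω - θ)) : EuclideanSpace ℝ (Fin d)))
      atTop (id : EuclideanSpace ℝ (Fin d) → EuclideanSpace ℝ (Fin d))
      (fun _ => Pr)
      (multivariateGaussian 0 (aggCov V S (fun i => (V i).Wstar μ S θ σ) W)) := by
  have hx_indep : ∀ i, iIndepFun (x i) Pr := fun i =>
    (hindep.precomp (g := fun k : ℕ => (i, k)) fun a b h => (Prod.mk.inj h).2).comp
      (fun _ p => p.1) fun _ => measurable_fst
  have hQ : ∀ i, (scoreCov (V i) μ S θ σ).PosSemidef := fun i =>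
    (posDef_scoreCov (V i) hS (hmisfit i) hσ).posSemidef
  let u : (i : Fin m) → ℕ → Ω → Fin (V i).obs → ℝ := fun i k ω =>
    (V i).score S θ (x i k ω, ξ i k ω)
  have hscore_meas : ∀ i a, Measurable fun p => (V i).score S θ p a := fun i a =>
    (measurable_pi_apply a).comp (measurable_score (V i))
  have hclt := tendstoInDistribution_groups (Pr := Pr) (u := u) hQ
    (hindep.comp (fun p q => (V p.1).score S θ q) fun p => measurable_score (V p.1))
    (fun i k => IdentDistrib.comp ⟨(hpair i k).aemeasurable, (hpair i 0).aemeasurable,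
      (hpair i k).map_eq.trans (hpair i 0).map_eq.symm⟩ (measurable_score (V i)))
    (fun i a => by
      have h := memLp_score (V i) hmem (hmisfit i) hγ a
      rw [← (hpair i 0).map_eq] at h
      exact h.comp_of_map (hpair i 0).aemeasurable)
    (fun i a => by
      rw [← integral_score (V i) hS hmem hcov (hmisfit i) hγ hγ0 a]
      exact (hpair i 0).integral_comp (hscore_meas i a).aestronglyMeasurable)
    (fun i a b => by
      rw [← integral_score_mul_score (V i) hmem hcov (hmisfit i) hγ hγ0 hγ2 a b]
      exact (hpair i 0).integral_comp
        ((hscore_meas i a).mul (hscore_meas i b)).aestronglyMeasurable)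
  let B : ℕ → Ω → (i : Fin m) → Fin (V i).obs → Fin (V i).obs → ℝ := fun n ω i a b =>
    pinv ((n : ℝ)⁻¹ • (((V i).dataPlus (dataMat x i n ω))ᵀ * (V i).dataPlus (dataMat x i n ω))) a b
  have hBmeas : ∀ n, AEMeasurable (B n) Pr := fun n => by
    refine aemeasurable_pi_lambda _ fun i => aemeasurable_pi_lambda _ fun a =>
      aemeasurable_pi_lambda _ fun b => aemeasurable_pinv (fun a b => ?_) a b
    have hP : ∀ k a, AEMeasurable (fun ω => ((V i).Pplus *ᵥ x i k ω) a) Pr := fun k a => by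
      simp only [View.Pplus_mulVec]
      exact aemeasurable_pi_iff.1 (hx i k).aemeasurable _
    simp only [Matrix.smul_apply, gram_apply, smul_eq_mul]
    exact (Finset.aemeasurable_fun_sum _ fun k _ => (hP k a).mul (hP k b)).const_mul _
  have hBlim : TendstoInMeasure Pr B atTop fun _ i a b => ((V i).blockPlus S)⁻¹ a b := by
    refine tendstoInMeasure_of_tendsto_ae (fun n => (hBmeas n).aestronglyMeasurable) ?_
    filter_upwards [ae_tendsto_pinv_gram (V := V) hS hmem hcov hx hx_indep] with ω h2
    exact tendsto_pi_nhds.2 h2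
  have hslutsky := hclt.continuous_comp_prodMk_of_tendstoInMeasure_const
    (continuous_aggErr (V := V) (S := S) W) hBlim hBmeas
  have hcovEq : aggCov V S (fun i => (V i).Wstar μ S θ σ) W =
      ∑ i, (aggGain V S W i * ((V i).blockPlus S)⁻¹) * scoreCov (V i) μ S θ σ *
        (aggGain V S W i * ((V i).blockPlus S)⁻¹)ᵀ := by
    refine Finset.sum_congr rfl fun i _ => ?_
    rw [inv_Wstar (V i) hS (hmisfit i) hσ, Matrix.transpose_mul, transpose_nonsing_inv,
      (V i).blockPlus_transpose hS]
    simp only [Matrix.mul_assoc]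
  have hmain := tendstoInDistribution_of_map_eq
    (P₂ := multivariateGaussian 0 (aggCov V S (fun i => (V i).Wstar μ S θ σ) W)) (Z₂ := id)
    hslutsky aemeasurable_id (by
      rw [Measure.map_id, hcovEq]
      exact map_aggErr_multivariateGaussian W hQ)
  have hmeas : ∀ n : ℕ, AEMeasurable (fun ω =>
      (WithLp.toLp 2 (√(n : ℝ) • (aggEst V S W x ξ θ n ω - θ)) : EuclideanSpace ℝ (Fin d))) Pr :=
    fun n => (WithLp.measurable_toLp 2 _).comp_aemeasurable (AEMeasurable.fun_const_smul
      ((aemeasurable_aggEst (fun i k => (hx i k).aemeasurable) hξ hW n).sub_const θ) _)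
  refine tendstoInDistribution_of_tendstoInMeasure_sub _ _ hmain ?_ hmeas
  refine tendstoInMeasure_of_tendsto_ae
    (fun n => ((hmeas n).sub (hmain.forall_aemeasurable n)).aestronglyMeasurable) ?_
  filter_upwards [ae_eventually_scaled_aggEst_sub (V := V) (ξ := ξ) (θ := θ) hS hmem hcov hx
    hx_indep hW] with ω hω
  refine tendsto_const_nhds.congr' ?_
  filter_upwards [hω, eventually_ne_atTop 0] with n hn hn0
  have hsqrt : √(n : ℝ) * (n : ℝ)⁻¹ = (√(n : ℝ))⁻¹ := by
    have h : 0 < (n : ℝ) := Nat.cast_pos.2 (Nat.pos_of_ne_zero hn0)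
    rw [← div_eq_mul_inv, Real.sqrt_div_self]
  have h := hn √(n : ℝ)
  rw [hsqrt] at h
  exact (sub_eq_zero.2 h).symm

end Asymptotics

end CollabLS

open CollabLS
theorem mainTheorem6 {Ω : Type*} [MeasurableSpace Ω] (Pr : Measure Ω) [IsProbabilityMeasure Pr]
    (d m : ℕ) (V : Fin m → View d)
    -- every feature is observed by at least one agent
    (hcover : ∀ j : Fin d, ∃ i : Fin m, ∃ a : Fin (V i).obs, (V i).perm (Sum.inl a) = j)
    -- law `μ` of the features: mean zero, covariance `S ≻ 0`
    (μ : Measure (Fin d → ℝ)) [IsProbabilityMeasure μ]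
    (S : Matrix (Fin d) (Fin d) ℝ) (hS : S.PosDef)
    (hmem : ∀ j, MemLp (fun v : Fin d → ℝ => v j) 2 μ)
    (hmean : ∀ j, ∫ v, v j ∂μ = 0)
    (hcov : ∀ j k, ∫ v, v j * v k ∂μ = S j k)
    -- true parameter and noise level
    (θ : Fin d → ℝ) (σ : ℝ) (hσ : 0 < σ)
    -- the expectations in the definition of the weights `Wᵢ⋆` exist
    (hmisfit : ∀ i a b, Integrable ((V i).misfit S θ a b) μ)
    -- features `x i k` and noise `ξ i k` of sample `k` of agent `i`
    (x : Fin m → ℕ → Ω → (Fin d → ℝ)) (ξ : Fin m → ℕ → Ω → ℝ)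
    (hx : ∀ i k, HasLaw (x i k) μ Pr)
    (hξ : ∀ i k, HasLaw (ξ i k) (gaussianReal 0 (σ ^ 2).toNNReal) Pr)
    (hxξ : ∀ i k, IndepFun (x i k) (ξ i k) Pr)
    (hindep : iIndepFun (fun (p : Fin m × ℕ) (ω : Ω) => (x p.1 p.2 ω, ξ p.1 p.2 ω)) Pr) :
    -- the local imputation estimator is a linear transform of local OLS, as soon as the observed
    -- data matrix has full column rank, and almost surely for all large `n`
    (∀ i n ω, ((V i).dataPlus (dataMat x i n ω)).rank = (V i).obs →
      impEst V S x ξ θ i n ω =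
        (((V i).T S)ᵀ * ((V i).T S * ((V i).T S)ᵀ)⁻¹) *ᵥ olsEst V x ξ θ i n ω) ∧
    (∀ i, ∀ᵐ ω ∂Pr, ∀ᶠ n in atTop,
      ((V i).dataPlus (dataMat x i n ω)).rank = (V i).obs ∧
      impEst V S x ξ θ i n ω =
        (((V i).T S)ᵀ * ((V i).T S * ((V i).T S)ᵀ)⁻¹) *ᵥ olsEst V x ξ θ i n ω) ∧
    -- positive definite weights, and the weights `Tᵢᵀ Wᵢ⋆ Tᵢ`, are admissible
    (∀ W : Fin m → Matrix (Fin d) (Fin d) ℝ, (∀ i, (W i).PosDef) → Admissible V S W) ∧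
    Admissible V S (fun i => ((V i).T S)ᵀ * (V i).Wstar μ S θ σ * (V i).T S) ∧
    -- `C⋆` is the inverse of an invertible matrix
    (∑ i, ((V i).T S)ᵀ * (V i).Wstar μ S θ σ * (V i).T S).PosDef ∧
    ∃ Cimp : (Fin m → Matrix (Fin d) (Fin d) ℝ) → Matrix (Fin d) (Fin d) ℝ,
      (∀ W : Fin m → Matrix (Fin d) (Fin d) ℝ, Admissible V S W →
        -- the aggregated estimator is well defined,
        (∀ n ω, ∃! t : Fin d → ℝ, ∀ t' : Fin d → ℝ,
          impLoss V S W (fun i => impEst V S x ξ θ i n ω) t ≤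
            impLoss V S W (fun i => impEst V S x ξ θ i n ω) t') ∧
        -- consistent,
        TendstoInMeasure Pr (fun n ω => aggEst V S W x ξ θ n ω) atTop (fun _ => θ) ∧
        -- asymptotically normal with covariance `Cimp W`,
        (Cimp W).PosSemidef ∧
        TendstoInDistribution
          (fun (n : ℕ) (ω : Ω) =>
            (WithLp.toLp 2 (√(n : ℝ) • (aggEst V S W x ξ θ n ω - θ)) : EuclideanSpace ℝ (Fin d)))
          atTop (id : EuclideanSpace ℝ (Fin d) → EuclideanSpace ℝ (Fin d))
          (fun _ => Pr) (multivariateGaussian 0 (Cimp W)) ∧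
        -- and its covariance dominates `C⋆`
        (Cimp W - Cstar V μ S θ σ).PosSemidef) ∧
      Cimp (fun i => ((V i).T S)ᵀ * (V i).Wstar μ S θ σ * (V i).T S) = Cstar V μ S θ σ := by
  have hpair : ∀ i k, HasLaw (fun ω => (x i k ω, ξ i k ω))
      (μ.prod (gaussianReal 0 (σ ^ 2).toNNReal)) Pr := fun i k =>
    (hxξ i k).hasLaw_prod (hx i k) (hξ i k)
  have hpair_indep : ∀ i, iIndepFun (fun k ω => (x i k ω, ξ i k ω)) Pr := fun i =>
    hindep.precomp (g := fun k : ℕ => (i, k)) fun a b h => (Prod.mk.inj h).2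
  have hx_indep : ∀ i, iIndepFun (x i) Pr := fun i =>
    (hpair_indep i).comp (fun _ p => p.1) fun _ => measurable_fst
  have hγ : MemLp id 2 (gaussianReal 0 (σ ^ 2).toNNReal) := memLp_id_gaussianReal 2
  have hγ0 : ∫ t, t ∂(gaussianReal 0 (σ ^ 2).toNNReal) = 0 := integral_id_gaussianReal
  have hγ2 : ∫ t, t ^ 2 ∂(gaussianReal 0 (σ ^ 2).toNNReal) = σ ^ 2 := by
    have h := variance_id_gaussianReal (μ := 0) (v := (σ ^ 2).toNNReal)
    rw [variance_of_integral_eq_zero aemeasurable_id hγ0, Real.coe_toNNReal _ (sq_nonneg σ)] at h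
    exact h
  have hWstar : ∀ i, ((V i).Wstar μ S θ σ).PosDef := fun i =>
    posDef_Wstar (V i) hS (hmisfit i) hσ
  have hM := posDef_sum_T_transpose_mul_mul_T hcover hS hWstar
  have hrank : ∀ i n ω, ((V i).dataPlus (dataMat x i n ω)).rank = (V i).obs →
      impEst V S x ξ θ i n ω =
        (((V i).T S)ᵀ * ((V i).T S * ((V i).T S)ᵀ)⁻¹) *ᵥ olsEst V x ξ θ i n ω := by
    intro i n ω h
    refine (V i).imp_eq_Tlift_mulVec_ols _ _ ((rank_eq_card_iff_isUnit_gram _).1 ?_)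
    rw [h, Fintype.card_fin]
  have hunit : ∀ i, ∀ᵐ ω ∂Pr, ∀ᶠ n in atTop, IsUnit
      (((V i).dataPlus (dataMat x i n ω))ᵀ * (V i).dataPlus (dataMat x i n ω)).det := fun i =>
    ae_eventually_isUnit_gram (V i) hS hmem hcov (hx i) (hx_indep i)
  refine ⟨hrank, fun i => ?_, fun W hW => admissible_of_posDef hcover hS hW,
    admissible_T_transpose_mul_mul_T hcover hS hWstar, hM,
    aggCov V S fun i => (V i).Wstar μ S θ σ, fun W hW => ⟨fun n ω => hW.existsUnique_minimizer _,
      ?_, posSemidef_aggCov hWstar W, ?_, hW.posSemidef_aggCov_sub hWstar hM⟩,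
    aggCov_T_transpose_mul_mul_T hWstar hM⟩
  · filter_upwards [hunit i] with ω hω
    filter_upwards [hω] with n hn
    have h := (rank_eq_card_iff_isUnit_gram _).2 hn
    rw [Fintype.card_fin] at h
    exact ⟨h, hrank i n ω h⟩
  · exact tendstoInMeasure_aggEst hS hmem hcov hmisfit hγ hγ0 hx (fun i k => (hξ i k).aemeasurable)
      hpair hindep hW
  · exact tendstoInDistribution_aggEst hS hmem hcov hmisfit hσ hγ hγ0 hγ2 hx
      (fun i k => (hξ i k).aemeasurable) hpair hindep hW
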